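/- Let $G$ be a groupoid (a small category in which all morphisms are isomorphisms) such that the set $\mathrm{mor}(G)$ of morphisms is finite. Write $d(g)$ and $c(g)$ for the domain and codomain of $g$, identify an object $e$ with its identity morphism, and write $G_e$ for the group of all $g$ with $d(g)=c(g)=e$. Rings are not assumed to be associative or unital. Let $\alpha=\{\alpha_g:R_{g^{-1}}\to R_g\}_{g\in\mathrm{mor}(G)}$ be a partial action of $G$ on a ring $R$. That is, for each $g$, $R_{c(g)}$ is a (two-sided) ideal of $R$, $R_g$ is an ideal of $R_{c(g)}$, and $\alpha_g$ is a ring isomorphism, such that: (P1) $\alpha_e=\mathrm{id}_{R_e}$ for every object $e$; (P2) $\alpha_h^{-1}(R_h\cap R_{g^{-1}})\subseteq R_{(gh)^{-1}}$ whenever $d(g)=c(h)$; (P3) $\alpha_g(\alpha_h(x))=\alpha_{gh}(x)$ whenever $d(g)=c(h)$ and $x\in\alpha_h^{-1}(R_h\cap R_{g^{-1}})$; (P4) $R=\bigoplus_{e\in\mathrm{ob}(G)}R_e$. Assume that $\alpha$ is unital, i.e. every non-zero $R_g$ has a multiplicative identity. The partial skew groupoid ring $R\star_\alpha G$ is the set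 of finite formal sums $\sum_g r_g\delta_g$ with $r_g\in R_g$, with componentwise addition and the biadditive multiplication given by $(r\delta_g)(r'\delta_h)=\alpha_g(\alpha_{g^{-1}}(r)\,r')\,\delta_{gh}$ if $d(g)=c(h)$, and $(r\delta_g)(r'\delta_h)=0$ otherwise. Theorem. Suppose that for every object $e$ of $G$ the integer $|G_e|$ is invertible in $R$ (that is, $R$ has an identity $1_R$ and $|G_e|\,1_R$ is invertible in $R$). (a) If $R$ is semisimple in the sense of being a finite direct sum of simple rings (a simple ring being a non-zero ring whose only two-sided ideals are the zero ideal and the ring itself; the empty sum is the zero ring), then so is $R\star_\alpha G$. (b) If $R$ is semisimple in the module-theoretic sense (an associative ring with identity that is a semisimple left module over itself), then so is $R\star_\alpha G$. -/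

import Mathlib

open CategoryTheory

universe u v w

namespace PartialSkew

section Rings

/-- `u` is a two-sided multiplicative identity of the (not necessarily associative) ring `A`. -/
def IsIdentity {A : Type w} [NonUnitalNonAssocRing A] (u : A) : Prop :=
  ∀ x : A, u * x = x ∧ x * u = x

/-- The natural number `n` is invertible in `A`: the ring `A` has an identity `1`, and the
element `n • 1` has a two-sided inverse. -/
def NatInvertibleIn (n : ℕ) (A : Type w) [NonUnitalNonAssocRing A] : Prop :=
  ∃ one : A, IsIdentity one ∧ ∃ s : A, (n • one) * s = one ∧ s * (n • one) = one

/-- A (not necessarily associative) ring is semisimple if it is a finite direct sum of simple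
rings. -/
def IsSemisimple (A : Type w) [NonUnitalNonAssocRing A] : Prop :=
  ∃ (n : ℕ) (S : Fin n → Type w) (_ : ∀ i, NonUnitalNonAssocRing (S i)),
    (∀ i, IsSimpleRing (S i)) ∧ Nonempty (A ≃+* ∀ i, S i)

/-- Semisimplicity in the module-theoretic (Wedderburn-Artin) sense: `A` is an associative ring
with identity which is semisimple as a left module over itself. -/
def IsModuleSemisimple (A : Type w) [NonUnitalNonAssocRing A] : Prop :=
  ∃ (B : Type w) (_ : Ring B), IsSemisimpleRing B ∧ Nonempty (A ≃+* B)

end Rings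

section Action

open Classical in
/-- A partial action of a groupoid `G` on a not necessarily associative ring `R`.
A morphism `g : e ⟶ f` has domain `e` and codomain `f`; the product `g h` of the groupoid
literature is the composite `h ≫ g`, and `R_e` for an object `e` is `D (𝟙 e)`. -/
structure PartialAction (G : Type u) [Groupoid.{v} G] (R : Type w) [NonUnitalNonAssocRing R] where
  /-- the family `R_g` -/
  D : ∀ {e f : G}, (e ⟶ f) → NonUnitalSubring R
  /-- `R_e` is an ideal of `R` -/
  mul_mem_obj : ∀ (e : G) (x y : R), x ∈ D (𝟙 e) → x * y ∈ D (𝟙 e) ∧ y * x ∈ D (𝟙 e)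
  /-- `R_g` is contained in `R_{c(g)}` -/
  le_cod : ∀ {e f : G} (g : e ⟶ f), D g ≤ D (𝟙 f)
  /-- `R_g` is an ideal of `R_{c(g)}` -/
  mul_mem_hom : ∀ {e f : G} (g : e ⟶ f) (x y : R), x ∈ D g → y ∈ D (𝟙 f) →
    x * y ∈ D g ∧ y * x ∈ D g
  /-- the ring isomorphisms `α_g : R_{g⁻¹} → R_g` -/
  act : ∀ {e f : G} (g : e ⟶ f), D (Groupoid.inv g) ≃+* D g
  /-- `α_e` is the identity of `R_e` -/
  act_id : ∀ (e : G) (x : D (Groupoid.inv (𝟙 e))), (act (𝟙 e) x : R) = x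
  /-- `α_h⁻¹ (R_h ∩ R_{g⁻¹}) ⊆ R_{(gh)⁻¹}` -/
  mem_comp : ∀ {e f k : G} (g : f ⟶ k) (h : e ⟶ f) (x : D (Groupoid.inv h)),
    (act h x : R) ∈ D (Groupoid.inv g) → (x : R) ∈ D (Groupoid.inv (h ≫ g))
  /-- `α_g (α_h x) = α_{gh} x` for `x ∈ α_h⁻¹ (R_h ∩ R_{g⁻¹})` -/
  act_comp : ∀ {e f k : G} (g : f ⟶ k) (h : e ⟶ f) (x : D (Groupoid.inv h))
    (hx : (act h x : R) ∈ D (Groupoid.inv g)),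
    (act g ⟨act h x, hx⟩ : R) = act (h ≫ g) ⟨x, mem_comp g h x hx⟩
  /-- `R` is the direct sum of the ideals `R_e`, where `e` ranges over the objects of `G` -/
  isInternal : DirectSum.IsInternal fun e : G => (D (𝟙 e)).toAddSubgroup

variable {G : Type u} [Groupoid.{v} G] {R : Type w} [NonUnitalNonAssocRing R]

/-- The partial action is unital: every non-zero `R_g` has an identity. -/
def PartialAction.IsUnital (α : PartialAction G R) : Prop :=
  ∀ {e f : G} (g : e ⟶ f), α.D g ≠ ⊥ → ∃ u : α.D g, IsIdentity u

/-- The set `mor(G)` of all morphisms of `G`. -/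
structure Mor (G : Type u) [Groupoid.{v} G] where
  dom : G
  cod : G
  hom : dom ⟶ cod

namespace PartialAction

variable (α : PartialAction G R)

theorem inv_inv' {e f : G} (g : e ⟶ f) : Groupoid.inv (Groupoid.inv g) = g := by simp

theorem mem_inv_inv {e f : G} (g : e ⟶ f) (r : α.D g) :
    (r : R) ∈ α.D (Groupoid.inv (Groupoid.inv g)) := by
  rw [inv_inv']; exact r.2

/-- `α_{g⁻¹}`, as a map `R_g → R_{g⁻¹}`. -/
def actInv {e f : G} (g : e ⟶ f) (r : α.D g) : α.D (Groupoid.inv g) :=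
  α.act (Groupoid.inv g) ⟨r, α.mem_inv_inv g r⟩

theorem act_eq_of_eq {e f : G} {g h : e ⟶ f} (H : g = h) (x : α.D (Groupoid.inv g))
    (y : α.D (Groupoid.inv h)) (hxy : (x : R) = y) : (α.act g x : R) = α.act h y := by
  subst H
  rw [Subtype.ext hxy]

/-- `α_{g⁻¹}` is inverse to `α_g`. -/
theorem actInv_act {e f : G} (g : e ⟶ f) (x : α.D (Groupoid.inv g)) :
    α.actInv g (α.act g x) = x := by
  apply Subtype.ext
  have h := α.act_comp (Groupoid.inv g) g x (α.mem_inv_inv g _)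
  have h1 : (x : R) ∈ α.D (Groupoid.inv (𝟙 e)) := by
    have := α.le_cod (Groupoid.inv g) x.2
    simpa using this
  have h2 := α.act_eq_of_eq (Groupoid.comp_inv g)
    ⟨x, α.mem_comp (Groupoid.inv g) g x (α.mem_inv_inv g _)⟩ ⟨x, h1⟩ rfl
  exact h.trans (h2.trans (α.act_id e ⟨x, h1⟩))

theorem actInv_eq_symm {e f : G} (g : e ⟶ f) (r : α.D g) :
    α.actInv g r = (α.act g).symm r := by
  conv_lhs => rw [← (α.act g).apply_symm_apply r]
  exact α.actInv_act g _

/-- `α_g (R_{g⁻¹} ∩ R_h) ⊆ R_{gh}`. -/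
theorem act_mem_comp {e f k : G} (g : f ⟶ k) (h : e ⟶ f) (x : α.D (Groupoid.inv g))
    (hx : (x : R) ∈ α.D h) : (α.act g x : R) ∈ α.D (h ≫ g) := by
  have key := α.mem_comp (Groupoid.inv h) (Groupoid.inv g)
    ⟨α.act g x, α.mem_inv_inv g _⟩ (by
      have h1 := congrArg Subtype.val (α.actInv_act g x)
      rw [inv_inv']
      change ((α.actInv g (α.act g x) : α.D (Groupoid.inv g)) : R) ∈ α.D h
      rw [h1]; exact hx)
  simpa using key

theorem actInv_mul_mem {e f k : G} (g : f ⟶ k) (h : e ⟶ f) (r : α.D g) (r' : α.D h) :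
    (α.actInv g r : R) * r' ∈ α.D (Groupoid.inv g) :=
  (α.mul_mem_hom (Groupoid.inv g) _ _ (α.actInv g r).2 (α.le_cod h r'.2)).1

theorem actInv_mul_mem' {e f k : G} (g : f ⟶ k) (h : e ⟶ f) (r : α.D g) (r' : α.D h) :
    (α.actInv g r : R) * r' ∈ α.D h :=
  (α.mul_mem_hom h _ _ r'.2 (α.le_cod (Groupoid.inv g) (α.actInv g r).2)).2

/-- The coefficient `α_g (α_{g⁻¹}(r) r')` of `δ_{gh}` in the product `(r δ_g) (r' δ_h)`. -/
def coeffMul {e f k : G} (g : f ⟶ k) (h : e ⟶ f) (r : α.D g) (r' : α.D h) : α.D (h ≫ g) :=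
  ⟨α.act g ⟨α.actInv g r * r', α.actInv_mul_mem g h r r'⟩,
    α.act_mem_comp g h _ (α.actInv_mul_mem' g h r r')⟩

theorem actInv_add {e f : G} (g : e ⟶ f) (r s : α.D g) :
    α.actInv g (r + s) = α.actInv g r + α.actInv g s := by
  simp only [actInv_eq_symm, map_add]

/-- `coeffMul` as a biadditive map. -/
def coeffMulHom {e f k : G} (g : f ⟶ k) (h : e ⟶ f) : α.D g →+ α.D h →+ α.D (h ≫ g) :=
  AddMonoidHom.mk' (fun r => AddMonoidHom.mk' (fun r' => α.coeffMul g h r r') (by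
    intro a b
    apply Subtype.ext
    change (α.act g _ : R) = (α.act g _ : R) + (α.act g _ : R)
    rw [← AddMemClass.coe_add, ← map_add]
    congr 2
    apply Subtype.ext
    simp [mul_add])) (by
    intro a b
    ext r'
    change (α.act g _ : R) = (α.act g _ : R) + (α.act g _ : R)
    rw [← AddMemClass.coe_add, ← map_add]
    congr 2
    apply Subtype.ext
    simp [actInv_add, add_mul])

/-- The underlying additive group of the partial skew groupoid ring `R ⋆_α G`: finite formal
sums `∑ r_g δ_g` with `r_g ∈ R_g`. -/
def SkewRing : Type (max u v w) := DirectSum (Mor G) fun m => α.D m.hom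

noncomputable instance : AddCommGroup α.SkewRing :=
  inferInstanceAs (AddCommGroup (DirectSum (Mor G) fun m => α.D m.hom))

open Classical in
/-- The element `r δ_g`. -/
noncomputable def single {e f : G} (g : e ⟶ f) : α.D g →+ α.SkewRing :=
  DirectSum.of (fun m : Mor G => α.D m.hom) ⟨e, f, g⟩

open Classical in
/-- The product `(r δ_g) (r' δ_h)`, which is `α_g (α_{g⁻¹}(r) r') δ_{gh}` if `g` and `h` are
composable and zero otherwise. -/
noncomputable def homMul : ∀ m n : Mor G, α.D m.hom →+ α.D n.hom →+ α.SkewRing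
  | ⟨f, _, g⟩, ⟨_, f', h⟩ =>
    if H : f' = f then by
      subst H
      exact (AddMonoidHom.compHom (α.single (h ≫ g))).comp (α.coeffMulHom g h)
    else 0

open Classical in
/-- The biadditive extension of `homMul`. -/
noncomputable def mulHom : α.SkewRing →+ α.SkewRing →+ α.SkewRing :=
  DirectSum.toAddMonoid fun m => AddMonoidHom.flip (DirectSum.toAddMonoid fun n =>
    AddMonoidHom.flip (α.homMul m n))

/-- The partial skew groupoid ring `R ⋆_α G`. -/
noncomputable instance : NonUnitalNonAssocRing α.SkewRing :=
  { (inferInstance : AddCommGroup α.SkewRing) with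
    mul := fun x y => α.mulHom x y
    left_distrib := fun x y z => (α.mulHom x).map_add y z
    right_distrib := fun x y z => by
      change α.mulHom (x + y) z = α.mulHom x z + α.mulHom y z
      rw [map_add]; rfl
    zero_mul := fun x => by
      change α.mulHom 0 x = 0
      rw [map_zero]; rfl
    mul_zero := fun x => (α.mulHom x).map_zero }

theorem mulHom_single {e f e' f' : G} (g : e ⟶ f) (h : e' ⟶ f') (r : α.D g) (r' : α.D h) :
    α.single g r * α.single h r' = α.homMul ⟨e, f, g⟩ ⟨e', f', h⟩ r r' := by
  classical
  have h1 : α.mulHom (α.single g r) =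
      AddMonoidHom.flip (DirectSum.toAddMonoid fun n =>
        AddMonoidHom.flip (α.homMul ⟨e, f, g⟩ n)) r :=
    DirectSum.toAddMonoid_of (β := fun m : Mor G => α.D m.hom) _ ⟨e, f, g⟩ r
  have h2 := DirectSum.toAddMonoid_of (β := fun m : Mor G => α.D m.hom)
    (fun n => AddMonoidHom.flip (α.homMul ⟨e, f, g⟩ n)) ⟨e', f', h⟩ r'
  exact (DFunLike.congr_fun h1 _).trans (DFunLike.congr_fun h2 r)

/-- The multiplication rule for composable `g`, `h`. -/
theorem single_mul_single {e f k : G} (g : f ⟶ k) (h : e ⟶ f) (r : α.D g) (r' : α.D h) :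
    α.single g r * α.single h r' = α.single (h ≫ g) (α.coeffMul g h r r') := by
  rw [mulHom_single]
  simp only [homMul, dif_pos]
  rfl

/-- The multiplication rule for non-composable `g`, `h`. -/
theorem single_mul_single_of_ne {e f e' f' : G} (g : e ⟶ f) (h : e' ⟶ f') (H : f' ≠ e)
    (r : α.D g) (r' : α.D h) : α.single g r * α.single h r' = 0 := by
  rw [mulHom_single]
  simp only [homMul, dif_neg H]
  rfl

end PartialAction

end Action

end PartialSkew

/-! The argument is Maschke's theorem for two-sided ideals. Write A for the partial skew groupoid
ring. A ring with identity is a finite direct sum of simple rings as soon as it is a semisimple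
module over its multiplication ring, whose submodules are the two-sided ideals
(`isSemisimple_of_isSemisimpleModule`). So every ideal of A has to be split off.

As a bimodule over the diagonal copy of R, A is the sum of the pieces E_i R δ_g, where the E_i are
the minimal central idempotents of R; each piece is zero or simple (`isSemisimpleModule_diag`).
Hence an ideal I of A is the image of an R-bilinear projection p. Averaging p, with terms δ_g a
p(δ_{g⁻¹} y) on the left and then the mirror image on the right, makes it A-bilinear, and it still
restricts to the identity on I provided that a is central of trace one: the sum of α_g(a) over all g
with codomain c is 1_c.

Such an a exists (`exists_trace_eq_one`). The 1_g are sums of some of the E_i, hence central, and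
each α_g partially permutes the E_i (`total_idem`). Take a to be the sum, over orbit representatives
E_i, of E_i divided by the order of its stabilizer. That order divides some |G_e|, so it is
invertible.

Associativity of R is never used for (a): elements x δ_g with x central in R are nuclear in A
(`monomial_isNuclear`), and only these need to be moved across brackets. For (b), A is finitely
generated over the artinian ring R, hence artinian, and an artinian finite direct sum of simple
rings has zero Jacobson radical. -/

namespace PartialSkew

/-! ### Finite sums of simple rings: central idempotents and the multiplication ring. -/

section SemisimpleRings

variable {A : Type w} [NonUnitalNonAssocRing A]

/-- A finite complete system `e` of orthogonal central idempotents, each of which generates a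
minimal ideal. -/
structure SimpleIdempotents (one : A) {n : ℕ} (e : Fin n → A) : Prop where
  central : ∀ i, e i ∈ Set.center A
  ortho : ∀ i j, i ≠ j → e i * e j = 0
  idem : ∀ i, e i * e i = e i
  sum_eq : ∑ i, e i = one
  ne_zero : ∀ i, e i ≠ 0
  minimal : ∀ i (J : TwoSidedIdeal A) (z : A), z ∈ J → z ≠ 0 → e i * z = z → e i ∈ J

theorem IsIdentity.mem_center {one : A} (h : IsIdentity one) : one ∈ Set.center A where
  comm x := by rw [commute_iff_eq, (h x).1, (h x).2]
  left_assoc x y := by rw [(h _).1, (h x).1]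
  right_assoc x y := by rw [(h _).2, (h y).2]

/-- The idempotents are the components of the identity in the simple factors. Minimality holds
because an ideal of the ring restricts to an ideal of each factor, which is zero or everything. -/
theorem IsSemisimple.exists_simpleIdempotents {one : A} (h1 : IsIdentity one)
    (h : IsSemisimple A) : ∃ (n : ℕ) (e : Fin n → A), SimpleIdempotents one e := by
  obtain ⟨n, S, _, hS, ⟨φ⟩⟩ := h
  have hu : ∀ i (x : S i), φ one i * x = x ∧ x * φ one i = x := by
    intro i x
    have h2 := h1 (φ.symm (Pi.single i x))
    have ha := congrFun (congrArg φ h2.1) i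
    have hb := congrFun (congrArg φ h2.2) i
    simp only [map_mul, RingEquiv.apply_symm_apply, Pi.mul_apply, Pi.single_eq_same] at ha hb
    exact ⟨ha, hb⟩
  have hz : ∀ i z, φ.symm (Pi.single i (φ one i)) * z = z → Pi.single i (φ z i) = φ z := by
    intro i z h
    conv_rhs => rw [← h]
    rw [map_mul, RingEquiv.apply_symm_apply]
    funext j
    by_cases hj : j = i
    · subst hj; simp [(hu j _).1]
    · simp [hj]
  refine ⟨n, fun i => φ.symm (Pi.single i (φ one i)), ⟨fun i => ?_, fun i j hij => ?_, fun i => ?_,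
    ?_, fun i h => ?_, fun i J z hJ h0 h => ?_⟩⟩
  · have : Pi.single i (φ one i) ∈ Set.center (∀ i, S i) := by
      rw [Set.center_pi]
      intro j _
      by_cases hj : j = i
      · subst hj
        rw [Pi.single_eq_same]
        exact IsIdentity.mem_center (hu j)
      · rw [Pi.single_eq_of_ne hj]; exact Set.zero_mem_center
    exact MulEquivClass.apply_mem_center φ.symm this
  · rw [← map_mul, ← map_zero φ.symm]
    congr 1
    funext k
    by_cases hk : k = i
    · subst hk; simp [hij]
    · simp [hk]
  · rw [← map_mul]
    congr 1
    rw [← Pi.single_mul, (hu i _).1]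
  · rw [← map_sum, Finset.univ_sum_single, RingEquiv.symm_apply_apply]
  · have h2 : φ one i = 0 := by
      rw [map_eq_zero_iff _ φ.symm.injective] at h
      simpa using congrFun h i
    obtain ⟨x, hx⟩ := exists_ne (0 : S i)
    exact hx (by rw [← (hu i x).1, h2, zero_mul])
  · let J' : TwoSidedIdeal (S i) := TwoSidedIdeal.mk' {x | φ.symm (Pi.single i x) ∈ J}
      (by simp [J.zero_mem]) (fun hx hy => by
        simp only [Set.mem_ofPred_eq, Pi.single_add, map_add] at *
        exact J.add_mem hx hy) (fun hx => by
        simp only [Set.mem_ofPred_eq, Pi.single_neg, map_neg] at *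
        exact J.neg_mem hx) (fun hy => by
        simp only [Set.mem_ofPred_eq, Pi.single_mul, map_mul] at *
        exact J.mul_mem_left _ _ hy) (fun hy => by
        simp only [Set.mem_ofPred_eq, Pi.single_mul, map_mul] at *
        exact J.mul_mem_right _ _ hy)
    have hJ' : ∀ x, x ∈ J' ↔ φ.symm (Pi.single i x) ∈ J := fun x =>
      TwoSidedIdeal.mem_mk' _ _ _ _ _ _ _
    have h3 : φ z i ∈ J' := by
      rw [hJ', hz i z h, RingEquiv.symm_apply_apply]; exact hJ
    rcases eq_bot_or_eq_top J' with h4 | h4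
    · rw [h4, TwoSidedIdeal.mem_bot] at h3
      refine absurd ?_ h0
      apply φ.injective
      rw [← hz i z h, h3, map_zero, Pi.single_zero]
    · exact (hJ' _).1 (h4 ▸ trivial)

/-- The ring of additive endomorphisms of `A` generated by the left and right multiplications by
elements of `X`. -/
def multRing (X : Set A) : Subring (AddMonoid.End A) :=
  Subring.closure (AddMonoid.End.mulLeft '' X ∪ AddMonoid.End.mulRight '' X)

theorem multRing_induction {X : Set A} {P : AddMonoid.End A → Prop}
    (hl : ∀ x ∈ X, P (AddMonoid.End.mulLeft x)) (hr : ∀ x ∈ X, P (AddMonoid.End.mulRight x))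
    (h0 : P 0) (h1 : P 1) (hadd : ∀ f g, P f → P g → P (f + g)) (hneg : ∀ f, P f → P (-f))
    (hmul : ∀ f g, P f → P g → P (f * g)) (f : multRing X) : P f := by
  obtain ⟨f, hf⟩ := f
  refine Subring.closure_induction (p := fun f _ => P f) ?_ h0 h1 (fun f g _ _ => hadd f g)
    (fun f _ => hneg f) (fun f g _ _ => hmul f g) hf
  rintro _ (⟨x, hx, rfl⟩ | ⟨x, hx, rfl⟩)
  exacts [hl x hx, hr x hx]

/-- The left multiplication by an element of `X`. -/
def multRing.left {X : Set A} (x : A) (hx : x ∈ X) : multRing X :=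
  ⟨AddMonoid.End.mulLeft x, Subring.subset_closure (Or.inl ⟨x, hx, rfl⟩)⟩

/-- The right multiplication by an element of `X`. -/
def multRing.right {X : Set A} (x : A) (hx : x ∈ X) : multRing X :=
  ⟨AddMonoid.End.mulRight x, Subring.subset_closure (Or.inr ⟨x, hx, rfl⟩)⟩

theorem multRing.left_smul {X : Set A} (x : A) (hx : x ∈ X) (y : A) :
    multRing.left x hx • y = x * y := rfl

theorem multRing.right_smul {X : Set A} (x : A) (hx : x ∈ X) (y : A) :
    multRing.right x hx • y = y * x := rfl

/-- An additive subgroup stable under the multiplications by elements of `X`, as a submodule. -/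
def toSubmodule {X : Set A} (J : AddSubgroup A) (hl : ∀ x ∈ X, ∀ y ∈ J, x * y ∈ J)
    (hr : ∀ x ∈ X, ∀ y ∈ J, y * x ∈ J) : Submodule (multRing X) A :=
  { J with
    smul_mem' := fun f y hy =>
      multRing_induction (P := fun f => ∀ y ∈ J, f y ∈ J) hl hr (fun _ _ => J.zero_mem)
        (fun _ h => h) (fun _ _ h h' y hy => J.add_mem (h y hy) (h' y hy))
        (fun _ h y hy => J.neg_mem (h y hy)) (fun _ _ h h' y hy => h _ (h' y hy)) f y hy }

theorem mem_toSubmodule {X : Set A} {J : AddSubgroup A} {hl : ∀ x ∈ X, ∀ y ∈ J, x * y ∈ J}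
    {hr : ∀ x ∈ X, ∀ y ∈ J, y * x ∈ J} {y : A} : y ∈ toSubmodule J hl hr ↔ y ∈ J := Iff.rfl

/-- An additive map commuting with the multiplications by elements of `X`, as a linear map. -/
def toLinearMap {X : Set A} (p : A →+ A) (hl : ∀ x ∈ X, ∀ y, p (x * y) = x * p y)
    (hr : ∀ x ∈ X, ∀ y, p (y * x) = p y * x) : A →ₗ[multRing X] A :=
  { p with
    map_smul' := fun f y =>
      multRing_induction (P := fun f => ∀ y, p (f y) = f (p y)) hl hr (fun _ => map_zero p)
        (fun _ => rfl) (fun f g h h' y => by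
          change p (f y + g y) = f (p y) + g (p y)
          rw [map_add, h, h'])
        (fun f h y => by
          change p (-f y) = -f (p y)
          rw [map_neg, h])
        (fun f g h h' y => by
          change p (f (g y)) = f (g (p y))
          rw [h, h']) f y }

theorem submodule_mul_mem_left (I : Submodule (multRing (Set.univ : Set A)) A) (x : A) {y : A}
    (hy : y ∈ I) : x * y ∈ I := I.smul_mem (multRing.left x trivial) hy

theorem submodule_mul_mem_right (I : Submodule (multRing (Set.univ : Set A)) A) (x : A) {y : A}
    (hy : y ∈ I) : y * x ∈ I := I.smul_mem (multRing.right x trivial) hy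

/-- A submodule of `A` over its multiplication ring, as a subring. -/
def submoduleSubring (I : Submodule (multRing (Set.univ : Set A)) A) : NonUnitalSubring A :=
  { I.toAddSubgroup with mul_mem' := fun {x _} _ hy => submodule_mul_mem_left I x hy }

/-- Distinct summands annihilate each other, since a product lies in both. Hence an ideal of one
summand is already an ideal of `A`, so a summand that is a minimal ideal is a simple ring. -/
theorem isSemisimple_of_isInternal {ι : Type*} [Finite ι] [DecidableEq ι]
    (M : ι → Submodule (multRing (Set.univ : Set A)) A) (hM : DirectSum.IsInternal M)
    (hs : ∀ i, IsAtom (M i)) : IsSemisimple A := by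
  have : Fintype ι := Fintype.ofFinite ι
  have hz : ∀ i j, i ≠ j → ∀ x ∈ M i, ∀ y ∈ M j, x * y = 0 := by
    intro i j hij x hx y hy
    have h := hM.submodule_iSupIndep.pairwiseDisjoint hij
    exact Submodule.disjoint_def.1 h _ (submodule_mul_mem_right _ _ hx)
      (submodule_mul_mem_left _ _ hy)
  have hsum : ∀ x : A, ∃ f : ∀ i, submoduleSubring (M i), x = ∑ i, (f i : A) := by
    intro x
    have hx : x ∈ ⨆ i, M i := by rw [hM.submodule_iSup_eq_top]; trivial
    obtain ⟨f, hf⟩ := (Submodule.mem_iSup_iff_exists_finsupp M x).1 hx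
    refine ⟨fun i => ⟨f i, hf.1 i⟩, ?_⟩
    exact hf.2.symm.trans (Finsupp.sum_fintype _ _ (fun _ => rfl))
  have hmul : ∀ (f : ∀ i, submoduleSubring (M i)) (j : ι) (y : submoduleSubring (M j)),
      (∑ i, (f i : A)) * y = f j * y := by
    intro f j y
    rw [Finset.sum_mul, Finset.sum_eq_single j]
    · intro i _ hij
      exact hz i j hij _ (f i).2 _ y.2
    · simp
  have hmul' : ∀ (f : ∀ i, submoduleSubring (M i)) (j : ι) (y : submoduleSubring (M j)),
      y * (∑ i, (f i : A)) = y * f j := by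
    intro f j y
    rw [Finset.mul_sum, Finset.sum_eq_single j]
    · intro i _ hij
      exact hz j i hij.symm _ y.2 _ (f i).2
    · simp
  let φ : (∀ i, submoduleSubring (M i)) →ₙ+* A :=
    { toFun := fun f => ∑ i, (f i : A)
      map_zero' := by simp
      map_add' := fun f g => by simp [Finset.sum_add_distrib]
      map_mul' := fun f g => by
        conv_rhs => rw [Finset.mul_sum]
        exact Finset.sum_congr rfl fun i _ => (hmul f i (g i)).symm }
  have hφ : Function.Bijective φ := by
    constructor
    · rw [injective_iff_map_eq_zero]
      intro f hf
      funext i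
      apply Subtype.ext
      refine Submodule.disjoint_def.1 (hM.submodule_iSupIndep i) _ (f i).2 ?_
      have h : ∑ j, (f j : A) = 0 := hf
      rw [← Finset.add_sum_erase _ _ (Finset.mem_univ i)] at h
      rw [eq_neg_of_add_eq_zero_left h]
      refine Submodule.neg_mem _ (Submodule.sum_mem _ fun j hj => ?_)
      exact Submodule.mem_iSup_of_mem j (Submodule.mem_iSup_of_mem (Finset.ne_of_mem_erase hj)
        (f j).2)
    · intro x
      obtain ⟨f, hf⟩ := hsum x
      exact ⟨f, hf.symm⟩
  let k := Fintype.equivFin ι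
  refine ⟨Fintype.card ι, fun i => submoduleSubring (M (k.symm i)), fun i => inferInstance,
    fun i => ⟨?_⟩, ⟨(RingEquiv.ofBijective φ hφ).symm.trans ?_⟩⟩
  · suffices h : ∀ j, IsSimpleOrder (TwoSidedIdeal (submoduleSubring (M j))) from h _
    intro j
    have hne := (hs j).1
    obtain ⟨m, hm, hm0⟩ := (Submodule.ne_bot_iff _).1 hne
    have : Nontrivial (submoduleSubring (M j)) :=
      ⟨⟨m, hm⟩, 0, fun h => hm0 (congrArg Subtype.val h)⟩
    refine { eq_bot_or_eq_top := fun J => ?_ }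
    let J' : Submodule (multRing (Set.univ : Set A)) A :=
      toSubmodule (J.coeAddMonoidHom.range.map (NonUnitalSubringClass.subtype (submoduleSubring (M j))).toAddMonoidHom) (by
        rintro x - _ ⟨_, ⟨⟨y, hy⟩, rfl⟩, rfl⟩
        obtain ⟨f, rfl⟩ := hsum x
        refine ⟨f j * y, ⟨⟨_, J.mul_mem_left _ _ hy⟩, rfl⟩, ?_⟩
        exact (hmul f j y).symm) (by
        rintro x - _ ⟨_, ⟨⟨y, hy⟩, rfl⟩, rfl⟩
        obtain ⟨f, rfl⟩ := hsum x
        refine ⟨y * f j, ⟨⟨_, J.mul_mem_right _ _ hy⟩, rfl⟩, ?_⟩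
        exact (hmul' f j y).symm)
    have hJ' : ∀ y : submoduleSubring (M j), (y : A) ∈ J' ↔ y ∈ J := by
      intro y
      constructor
      · rintro ⟨_, ⟨⟨z, hz⟩, rfl⟩, h⟩
        have : z = y := Subtype.ext h
        exact this ▸ hz
      · intro hy
        exact ⟨y, ⟨⟨y, hy⟩, rfl⟩, rfl⟩
    have hle : J' ≤ M j := by
      rintro _ ⟨_, ⟨⟨z, hz⟩, rfl⟩, rfl⟩
      exact z.2
    rcases (hs j).le_iff.1 hle with h | h
    · left
      rw [eq_bot_iff]
      intro y hy
      rw [← hJ', h, Submodule.mem_bot] at hy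
      rw [TwoSidedIdeal.mem_bot]
      exact Subtype.ext hy
    · right
      rw [eq_top_iff]
      intro y _
      rw [← hJ', h]
      exact y.2
  · exact RingEquiv.piCongrLeft' (fun i => submoduleSubring (M i)) k

/-- The identity generates `A` over its multiplication ring, so a decomposition into minimal ideals
has only finitely many terms. -/
theorem isSemisimple_of_isSemisimpleModule {one : A} (h1 : IsIdentity one)
    (h : IsSemisimpleModule (multRing (Set.univ : Set A)) A) : IsSemisimple A := by
  classical
  have hfg : Module.Finite (multRing (Set.univ : Set A)) A := by
    refine ⟨⟨{one}, ?_⟩⟩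
    rw [eq_top_iff]
    intro x _
    rw [Finset.coe_singleton, Submodule.mem_span_singleton]
    exact ⟨multRing.left x trivial, (h1 x).2⟩
  obtain ⟨s, hs1, hs2, hs3⟩ := IsSemisimpleModule.exists_sSupIndep_sSup_simples_eq_top
    (multRing (Set.univ : Set A)) A
  have : Finite s := WellFoundedGT.finite_of_sSupIndep hs1
  refine isSemisimple_of_isInternal (fun i : s => (i : Submodule _ A)) ?_
    (fun i => isSimpleModule_iff_isAtom.1 (hs3 i i.2))
  rw [DirectSum.isInternal_submodule_iff_iSupIndep_and_iSup_eq_top]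
  exact ⟨(sSupIndep_iff _).1 hs1, by rw [← sSup_eq_iSup', hs2]⟩

end SemisimpleRings

end PartialSkew

/-! ### The maps x ↦ α_g(1_{g⁻¹} x) on all of R. -/

namespace PartialSkew

namespace PartialAction

section TotalMaps

variable {G : Type u} [Groupoid.{v} G] {R : Type w} [NonUnitalNonAssocRing R]
variable (α : PartialAction G R)

theorem inv_comp_rev {e f k : G} (g : f ⟶ k) (h : e ⟶ f) :
    Groupoid.inv (h ≫ g) = Groupoid.inv g ≫ Groupoid.inv h := by simp

theorem comp_comp_inv {e f k : G} (g : f ⟶ k) (h : e ⟶ f) :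
    (h ≫ g) ≫ Groupoid.inv g = h := by
  rw [Category.assoc, Groupoid.comp_inv, Category.comp_id]

theorem inv_comp_comp {e f k : G} (g : f ⟶ k) (h : e ⟶ f) :
    Groupoid.inv h ≫ h ≫ g = g := by
  rw [← Category.assoc, Groupoid.inv_comp, Category.id_comp]

theorem induction_of_obj {P : R → Prop} (h0 : P 0) (hadd : ∀ x y, P x → P y → P (x + y))
    (h : ∀ e, ∀ x ∈ α.D (𝟙 e), P x) (x : R) : P x := by
  classical
  obtain ⟨d, rfl⟩ := α.isInternal.2 x
  induction d using DirectSum.induction_on with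
  | zero => rwa [map_zero]
  | of e y =>
    erw [DirectSum.coeAddMonoidHom_of]
    exact h e _ y.2
  | add a b ha hb => rw [map_add]; exact hadd _ _ ha hb

theorem eq_zero_of_mem_of_mem {e f : G} (hef : e ≠ f) {x : R} (he : x ∈ α.D (𝟙 e))
    (hf : x ∈ α.D (𝟙 f)) : x = 0 := by
  classical
  have h := α.isInternal.addSubgroup_iSupIndep.pairwiseDisjoint hef
  exact AddSubgroup.disjoint_def.1 h he hf

/-- `R_g` is an ideal of `R`. -/
theorem mul_mem_D {e f : G} (g : e ⟶ f) {x : R} (hx : x ∈ α.D g) (y : R) :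
    x * y ∈ α.D g ∧ y * x ∈ α.D g := by
  refine α.induction_of_obj (P := fun y => x * y ∈ α.D g ∧ y * x ∈ α.D g) ?_ ?_ ?_ y
  · simp [zero_mem]
  · intro a b ha hb
    rw [mul_add, add_mul]
    exact ⟨add_mem ha.1 hb.1, add_mem ha.2 hb.2⟩
  · intro e' y hy
    by_cases h : e' = f
    · subst h; exact α.mul_mem_hom g x y hx hy
    · have h1 := α.mul_mem_obj e' y x hy
      have h2 := α.mul_mem_obj f x y (α.le_cod g hx)
      rw [α.eq_zero_of_mem_of_mem h h1.2 h2.1, α.eq_zero_of_mem_of_mem h h1.1 h2.2]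
      exact ⟨zero_mem _, zero_mem _⟩

/-- `R_g` as a two-sided ideal of `R`. -/
def ideal {e f : G} (g : e ⟶ f) : TwoSidedIdeal R :=
  TwoSidedIdeal.mk' (α.D g) (zero_mem _) (fun hx hy => add_mem hx hy) (fun hx => neg_mem hx)
    (fun hy => (α.mul_mem_D g hy _).2) (fun hy => (α.mul_mem_D g hy _).1)

theorem mem_ideal {e f : G} (g : e ⟶ f) {x : R} : x ∈ α.ideal g ↔ x ∈ α.D g :=
  TwoSidedIdeal.mem_mk' _ _ _ _ _ _ _

open Classical in
/-- The identity of `R_g` (zero if there is none). -/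
noncomputable def ident {e f : G} (g : e ⟶ f) : R :=
  if h : ∃ u : α.D g, IsIdentity u then (h.choose : R) else 0

theorem ident_mem {e f : G} (g : e ⟶ f) : α.ident g ∈ α.D g := by
  unfold ident
  split_ifs with h
  · exact h.choose.2
  · exact zero_mem _

variable {α}

theorem ident_mul_of_mem (hα : α.IsUnital) {e f : G} (g : e ⟶ f) {x : R} (hx : x ∈ α.D g) :
    α.ident g * x = x ∧ x * α.ident g = x := by
  by_cases h0 : α.D g = ⊥
  · rw [h0, NonUnitalSubring.mem_bot] at hx
    simp [hx]
  · have h := hα g h0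
    unfold ident
    rw [dif_pos h]
    have h1 := h.choose_spec ⟨x, hx⟩
    exact ⟨congrArg Subtype.val h1.1, congrArg Subtype.val h1.2⟩

/-- The product 1_g E_i lies in the ideal R_g and is fixed by E_i; if it is non-zero, minimality
forces E_i into R_g. -/
theorem ident_mul_idem (hα : α.IsUnital) {n : ℕ} {E : Fin n → R} {one : R}
    (hE : SimpleIdempotents one E) {e f : G} (g : e ⟶ f) (i : Fin n) :
    (α.ident g * E i = 0 ∧ E i ∉ α.D g) ∨ (α.ident g * E i = E i ∧ E i ∈ α.D g) := by
  by_cases h : E i ∈ α.D g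
  · exact Or.inr ⟨(ident_mul_of_mem hα g h).1, h⟩
  · refine Or.inl ⟨?_, h⟩
    by_contra h0
    apply h
    rw [← mem_ideal]
    refine hE.minimal i _ (α.ident g * E i) ?_ h0 ?_
    · rw [mem_ideal]; exact (α.mul_mem_D g (α.ident_mem g) _).1
    · rw [(hE.central i).left_comm, hE.idem]

/-- Expanding the identity of R as the sum of the E_i shows that 1_g is the sum of those E_i lying
in R_g. -/
theorem ident_central (hα : α.IsUnital) {n : ℕ} {E : Fin n → R} {one : R} (h1 : IsIdentity one)
    (hE : SimpleIdempotents one E) {e f : G} (g : e ⟶ f) : α.ident g ∈ Set.center R := by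
  rw [← (h1 (α.ident g)).2, ← hE.sum_eq, Finset.mul_sum, ← NonUnitalSubring.coe_center]
  refine sum_mem fun i _ => ?_
  rcases ident_mul_idem hα hE g i with h | h
  · rw [h.1]; exact zero_mem _
  · rw [h.1]; exact hE.central i

variable (α) in
/-- The map `x ↦ α_g (1_{g⁻¹} x)`. -/
noncomputable def total {e f : G} (g : e ⟶ f) : R →+ R :=
  AddMonoidHom.mk' (fun x => (α.act g ⟨α.ident (Groupoid.inv g) * x,
    (α.mul_mem_D _ (α.ident_mem _) x).1⟩ : R)) (fun x y => by
      rw [← AddMemClass.coe_add, ← map_add]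
      congr 2
      exact Subtype.ext (mul_add _ _ _))

theorem total_mem {e f : G} (g : e ⟶ f) (x : R) : α.total g x ∈ α.D g := (α.act g _).2

theorem total_of_mem (hα : α.IsUnital) {e f : G} (g : e ⟶ f) (x : α.D (Groupoid.inv g)) :
    α.total g x = α.act g x :=
  α.act_eq_of_eq rfl _ _ (ident_mul_of_mem hα _ x.2).1

theorem total_mem_comp {e f k : G} (g : f ⟶ k) (h : e ⟶ f) {x : R} (hx : x ∈ α.D h) :
    α.total g x ∈ α.D (h ≫ g) :=
  α.act_mem_comp g h _ (α.mul_mem_D h hx _).2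

variable (hα : α.IsUnital) (hc : ∀ {e f : G} (g : e ⟶ f), α.ident g ∈ Set.center R)

include hα

theorem ident_mul_ident {e f : G} (g : e ⟶ f) : α.ident g * α.ident g = α.ident g :=
  (ident_mul_of_mem hα g (α.ident_mem g)).1

theorem ident_mul_ident_cod {e f : G} (g : e ⟶ f) : α.ident g * α.ident (𝟙 f) = α.ident g :=
  (ident_mul_of_mem hα (𝟙 f) (α.le_cod g (α.ident_mem g))).2

theorem ident_mul_total {e f : G} (g : e ⟶ f) (x : R) :
    α.ident g * α.total g x = α.total g x := (ident_mul_of_mem hα g (total_mem g x)).1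

theorem total_mul_ident {e f : G} (g : e ⟶ f) (x : R) :
    α.total g x * α.ident g = α.total g x := (ident_mul_of_mem hα g (total_mem g x)).2

include hc

theorem ident_mul_ident_mul {e f : G} (g : e ⟶ f) (x : R) :
    α.ident g * (α.ident g * x) = α.ident g * x := by
  rw [(hc g).left_assoc, ident_mul_ident hα]

theorem ident_mul_mul_ident_mul {e f : G} (g : e ⟶ f) (x y : R) :
    (α.ident g * x) * (α.ident g * y) = α.ident g * (x * y) := by
  rw [← (hc g).left_assoc, ← (hc g).left_comm, ident_mul_ident_mul hα hc]

theorem total_ident_mul {e f : G} (g : e ⟶ f) (x : R) :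
    α.total g (α.ident (Groupoid.inv g) * x) = α.total g x :=
  α.act_eq_of_eq rfl _ _ (ident_mul_ident_mul hα hc _ _)

theorem total_mul {e f : G} (g : e ⟶ f) (x y : R) :
    α.total g (x * y) = α.total g x * α.total g y := by
  change (α.act g _ : R) = (α.act g _ : R) * (α.act g _ : R)
  rw [← MulMemClass.coe_mul, ← map_mul]
  refine α.act_eq_of_eq rfl _ _ ?_
  exact (ident_mul_mul_ident_mul hα hc _ x y).symm

omit hc in
theorem total_inv_total {e f : G} (g : e ⟶ f) (x : R) :
    α.total (Groupoid.inv g) (α.total g x) = α.ident (Groupoid.inv g) * x := by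
  have h := congrArg Subtype.val (α.actInv_act g ⟨α.ident (Groupoid.inv g) * x,
    (α.mul_mem_D _ (α.ident_mem _) x).1⟩)
  exact (total_of_mem hα (Groupoid.inv g) ⟨_, α.mem_inv_inv g _⟩).trans h

omit hc in
theorem total_total_inv {e f : G} (g : e ⟶ f) (x : R) :
    α.total g (α.total (Groupoid.inv g) x) = α.ident g * x := by
  have h := total_inv_total hα (Groupoid.inv g) x
  rwa [inv_inv'] at h

/-- Both sides act as the identity of R_g ∩ R_{gh}: the right side fixes p because p lies there, and
p fixes q because q is the image under α_g of an element of R_h. -/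
theorem total_ident {e f k : G} (g : f ⟶ k) (h : e ⟶ f) :
    α.total g (α.ident h) = α.ident g * α.ident (h ≫ g) := by
  set p := α.total g (α.ident h)
  set q := α.ident g * α.ident (h ≫ g)
  have hp : p * q = p := by
    rw [← (hc g).mid_assoc, total_mul_ident hα,
      (ident_mul_of_mem hα (h ≫ g) (total_mem_comp g h (α.ident_mem h))).2]
  have hz : α.total (Groupoid.inv g) q ∈ α.D h := by
    have := total_mem_comp (Groupoid.inv g) (h ≫ g) (x := q)
      (α.mul_mem_D _ (α.ident_mem _) _).2
    rwa [comp_comp_inv] at this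
  have hq : α.total g (α.total (Groupoid.inv g) q) = q := by
    rw [total_total_inv hα, ident_mul_ident_mul hα hc]
  calc p = p * α.total g (α.total (Groupoid.inv g) q) := by rw [hq, hp]
    _ = α.total g (α.ident h * α.total (Groupoid.inv g) q) := (total_mul hα hc _ _ _).symm
    _ = q := by rw [(ident_mul_of_mem hα h hz).1, hq]

/-- This is (P3) freed of its domain condition. Cutting x down by 1_{(gh)⁻¹} puts its image under
α_h into R_{g⁻¹}, where (P3) applies; the cut then leaves only the factor 1_g. -/
theorem total_total {e f k : G} (g : f ⟶ k) (h : e ⟶ f) (x : R) :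
    α.total g (α.total h x) = α.ident g * α.total (h ≫ g) x := by
  set y := α.ident (Groupoid.inv (h ≫ g)) * x with hy
  have h1 : α.total h y = α.ident (Groupoid.inv g) * α.total h x := by
    rw [hy, total_mul hα hc, total_ident hα hc, inv_comp_rev, Category.assoc, Groupoid.inv_comp,
      Category.comp_id, ← (hc h).left_assoc, (hc h).left_comm, ident_mul_total hα]
  have hm : α.ident (Groupoid.inv h) * y ∈ α.D (Groupoid.inv h) :=
    (α.mul_mem_D _ (α.ident_mem _) _).1
  have h2 : (α.act h ⟨_, hm⟩ : R) = α.total h y := rfl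
  have h3 : (α.act h ⟨_, hm⟩ : R) ∈ α.D (Groupoid.inv g) := by
    rw [h2, h1]
    exact (α.mul_mem_D _ (α.ident_mem _) _).1
  have h4 := α.act_comp g h ⟨_, hm⟩ h3
  rw [← total_of_mem hα g, ← total_of_mem hα (h ≫ g)] at h4
  change α.total g (α.total h y) = α.total (h ≫ g) (α.ident (Groupoid.inv h) * y) at h4
  rw [h1, total_ident_mul hα hc, total_mul hα hc, total_ident_mul hα hc, total_ident hα hc,
    inv_comp_comp, (hc g).comm (α.ident (h ≫ g)) |>.symm.eq, ← (hc g).left_assoc,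
    ident_mul_total hα] at h4
  exact h4

omit hα hc in
theorem total_id (e : G) (x : R) : α.total (𝟙 e) x = α.ident (𝟙 e) * x := by
  have h1 : Groupoid.inv (𝟙 e) = 𝟙 e := by simp
  have h2 := α.act_id e ⟨α.ident (Groupoid.inv (𝟙 e)) * x, (α.mul_mem_D _ (α.ident_mem _) x).1⟩
  change α.total (𝟙 e) x = α.ident (Groupoid.inv (𝟙 e)) * x at h2
  rwa [h1] at h2

/-- A product with α_g(z) depends only on the part 1_g x of the other factor, and every 1_g x is a
value of α_g. The identities defining the center are thus transported along the multiplicative map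
α_g. -/
theorem total_center {e f : G} (g : e ⟶ f) {z : R} (hz : z ∈ Set.center R) :
    α.total g z ∈ Set.center R := by
  have key : ∀ x, ∃ y, α.ident g * x = α.total g y := fun x =>
    ⟨_, (total_total_inv hα g x).symm⟩
  have hl : ∀ x, α.total g z * x = α.total g z * (α.ident g * x) := fun x => by
    rw [← (hc g).mid_assoc, total_mul_ident hα]
  have hr : ∀ x, x * α.total g z = (α.ident g * x) * α.total g z := fun x => by
    rw [(hc g).comm x, (hc g).mid_assoc, ident_mul_total hα]
  have hcomm : ∀ x, α.total g z * x = x * α.total g z := fun x => by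
    obtain ⟨y, hy⟩ := key x
    rw [hl, hr, hy, ← total_mul hα hc, ← total_mul hα hc, hz.comm]
  refine ⟨hcomm, fun b c => ?_, fun b c => ?_⟩
  · obtain ⟨y, hy⟩ := key b
    obtain ⟨y', hy'⟩ := key c
    have h1 : α.ident g * (b * c) = α.total g (y * y') := by
      rw [total_mul hα hc, ← hy, ← hy', ident_mul_mul_ident_mul hα hc]
    have h2 : α.total g z * b * c = α.total g (z * y) * α.total g y' := by
      rw [hl b, hy, ← total_mul hα hc, ← hy', ← (hc g).mid_assoc, total_mul_ident hα]
    rw [hl, h1, h2, ← total_mul hα hc, ← total_mul hα hc, hz.left_assoc]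
  · obtain ⟨y, hy⟩ := key b
    obtain ⟨y', hy'⟩ := key c
    have h1 : α.ident g * (b * c) = α.total g (y * y') := by
      rw [total_mul hα hc, ← hy, ← hy', ident_mul_mul_ident_mul hα hc]
    have h2 : b * (c * α.total g z) = α.total g y * α.total g (y' * z) := by
      rw [hr c, hy', ← total_mul hα hc, ← hy, (hc g).comm b, (hc g).mid_assoc,
        ident_mul_total hα]
    rw [hr, h1, h2, ← total_mul hα hc, ← total_mul hα hc, hz.right_assoc]

end TotalMaps

end PartialAction

end PartialSkew

/-! ### Monomials x δ_g, their nuclearity, and the diagonal copy of R. -/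

namespace PartialSkew

/-- The element `t` associates with all elements of the ring. -/
structure IsNuclear {A : Type w} [NonUnitalNonAssocRing A] (t : A) : Prop where
  left : ∀ x y, (t * x) * y = t * (x * y)
  mid : ∀ x y, (x * t) * y = x * (t * y)
  right : ∀ x y, (x * y) * t = x * (y * t)

namespace PartialAction

section Monomials

variable {G : Type u} [Groupoid.{v} G] {R : Type w} [NonUnitalNonAssocRing R]
variable {α : PartialAction G R}

variable (α) in
/-- The element `(1_g x) δ_g` of the partial skew groupoid ring. -/
noncomputable def monomial {e f : G} (g : e ⟶ f) : R →+ α.SkewRing :=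
  AddMonoidHom.mk' (fun x => α.single g ⟨α.ident g * x, (α.mul_mem_D g (α.ident_mem g) x).1⟩)
    (fun x y => by
      rw [← map_add]
      congr 1
      exact Subtype.ext (mul_add _ _ _))

theorem monomial_congr {e f : G} (g : e ⟶ f) {x y : R} (h : α.ident g * x = α.ident g * y) :
    α.monomial g x = α.monomial g y :=
  congrArg (α.single g) (Subtype.ext h)

theorem monomial_mul_of_ne {e f e' f' : G} (g : e ⟶ f) (h : e' ⟶ f') (H : f' ≠ e) (x y : R) :
    α.monomial g x * α.monomial h y = 0 :=
  α.single_mul_single_of_ne g h H _ _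

variable (hα : α.IsUnital) (hc : ∀ {e f : G} (g : e ⟶ f), α.ident g ∈ Set.center R)

include hα

theorem monomial_induction {P : α.SkewRing → Prop} (h0 : P 0)
    (hadd : ∀ x y, P x → P y → P (x + y)) (h : ∀ {e f : G} (g : e ⟶ f) (x : R),
      P (α.monomial g x)) (x : α.SkewRing) : P x := by
  classical
  refine DirectSum.induction_on (β := fun m : Mor G => α.D m.hom) (motive := P) x h0 ?_ hadd
  rintro ⟨e, f, g⟩ y
  have h1 : α.single g y = α.monomial g y :=
    congrArg (α.single g) (Subtype.ext (ident_mul_of_mem hα g y.2).1.symm)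
  change P (α.single g y)
  rw [h1]
  exact h g y

include hc

theorem monomial_ident_mul {e f : G} (g : e ⟶ f) (x : R) :
    α.monomial g (α.ident g * x) = α.monomial g x :=
  monomial_congr g (ident_mul_ident_mul hα hc g x)

theorem monomial_ident_cod_mul {e f : G} (g : e ⟶ f) (x : R) :
    α.monomial g (α.ident (𝟙 f) * x) = α.monomial g x :=
  monomial_congr g (by rw [(hc g).left_assoc, ident_mul_ident_cod hα])

theorem monomial_mul {e f k : G} (g : f ⟶ k) (h : e ⟶ f) (x y : R) :
    α.monomial g x * α.monomial h y = α.monomial (h ≫ g) (x * α.total g y) := by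
  change α.single g _ * α.single h _ = α.single (h ≫ g) _
  rw [single_mul_single]
  congr 1
  apply Subtype.ext
  have hx : (α.actInv g ⟨α.ident g * x, (α.mul_mem_D g (α.ident_mem g) x).1⟩ : R) =
      α.total (Groupoid.inv g) x := by
    have h1 := total_ident_mul hα hc (Groupoid.inv g) x
    rw [inv_inv'] at h1
    rw [← h1]
    exact (total_of_mem hα (Groupoid.inv g) ⟨_, α.mem_inv_inv g ⟨_, _⟩⟩).symm
  change (α.act g ⟨(α.actInv g _ : R) * (α.ident h * y), _⟩ : R) = _
  rw [← total_of_mem hα]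
  change α.total g ((α.actInv g _ : R) * (α.ident h * y)) = _
  rw [hx, total_mul hα hc, total_mul hα hc, total_total_inv hα, total_ident hα hc,
    (hc g).comm (α.ident (h ≫ g)), ← (hc (h ≫ g)).left_assoc, ident_mul_total hα,
    ← (hc (h ≫ g)).left_comm, (hc g).comm x, (hc g).mid_assoc, ident_mul_total hα]

/-- The two bracketings have coefficients differing only in the bracketing of x, α_g(y), α_{gh}(z).
The hypothesis `H` covers both an associative R and the case where one of x, y, z is central. -/
theorem monomial_assoc {e f e' f' e'' f'' : G} (g : e ⟶ f) (h : e' ⟶ f') (k : e'' ⟶ f'')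
    (x y z : R) (H : ∀ {a b c d : G} (m : a ⟶ b) (n : c ⟶ d),
      (x * α.total m y) * α.total n z = x * (α.total m y * α.total n z)) :
    (α.monomial g x * α.monomial h y) * α.monomial k z =
      α.monomial g x * (α.monomial h y * α.monomial k z) := by
  by_cases h1 : f' = e
  · subst h1
    by_cases h2 : f'' = e'
    · subst h2
      rw [monomial_mul hα hc, monomial_mul hα hc, monomial_mul hα hc, monomial_mul hα hc,
        total_mul hα hc, total_total hα hc, H, ← (hc g).mid_assoc, total_mul_ident hα,
        Category.assoc]
    · rw [monomial_mul hα hc, monomial_mul_of_ne _ _ h2, monomial_mul_of_ne _ _ h2, mul_zero]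
  · rw [monomial_mul_of_ne _ _ h1, zero_mul]
    by_cases h2 : f'' = e'
    · subst h2
      rw [monomial_mul hα hc, monomial_mul_of_ne _ _ h1]
    · rw [monomial_mul_of_ne _ _ h2, mul_zero]

theorem skewRing_mul_assoc (hR : ∀ x y z : R, (x * y) * z = x * (y * z)) (x y z : α.SkewRing) :
    (x * y) * z = x * (y * z) := by
  induction x using monomial_induction hα with
  | h0 => simp
  | hadd a b ha hb => rw [add_mul, add_mul, add_mul, ha, hb]
  | h g x =>
    induction y using monomial_induction hα with
    | h0 => simp
    | hadd a b ha hb => rw [add_mul, mul_add, mul_add, add_mul, ha, hb]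
    | h h y =>
      induction z using monomial_induction hα with
      | h0 => simp
      | hadd a b ha hb => rw [mul_add, mul_add, mul_add, ha, hb]
      | h k z => exact monomial_assoc hα hc g h k x y z fun _ _ => hR _ _ _

/-- This replaces associativity in the averaging argument, since the averaging weights are monomials
with central coefficients. -/
theorem monomial_isNuclear {e f : G} (g : e ⟶ f) {t : R} (ht : t ∈ Set.center R) :
    IsNuclear (α.monomial g t) := by
  refine ⟨fun x y => ?_, fun x y => ?_, fun x y => ?_⟩ <;>
  induction x using monomial_induction hα with
  | h0 => simp
  | hadd a b ha hb => simp only [add_mul, mul_add, ha, hb]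
  | h h x =>
    induction y using monomial_induction hα with
    | h0 => simp
    | hadd a b ha hb => simp only [add_mul, mul_add, ha, hb]
    | h k y =>
      refine monomial_assoc hα hc _ _ _ _ _ _ fun m n => ?_
      first
      | exact (ht.left_assoc _ _).symm
      | exact (total_center hα hc _ ht).mid_assoc _ _
      | exact (total_center hα hc _ ht).right_assoc _ _

omit hα hc in
variable (α) in
/-- The embedding `r ↦ ∑ r_e δ_e` of `R` into the partial skew groupoid ring. -/
noncomputable def diag [Fintype G] : R →+ α.SkewRing := ∑ e : G, α.monomial (𝟙 e)

omit hα hc in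
theorem diag_apply [Fintype G] (r : R) : α.diag r = ∑ e : G, α.monomial (𝟙 e) r := by
  simp [diag]

theorem diag_mul_monomial [Fintype G] {e f : G} (g : e ⟶ f) (r x : R) :
    α.diag r * α.monomial g x = α.monomial g (r * x) := by
  rw [diag_apply, Finset.sum_mul, Finset.sum_eq_single f]
  · rw [monomial_mul hα hc, total_id, Category.comp_id, ← (hc (𝟙 f)).left_comm,
      monomial_ident_cod_mul hα hc]
  · intro b _ hb
    exact monomial_mul_of_ne _ _ hb.symm _ _
  · simp

theorem monomial_mul_diag [Fintype G] {e f : G} (g : e ⟶ f) (x r : R) :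
    α.monomial g x * α.diag r = α.monomial g (x * α.total g r) := by
  rw [diag_apply, Finset.mul_sum, Finset.sum_eq_single e]
  · rw [monomial_mul hα hc, Category.id_comp]
  · intro b _ hb
    exact monomial_mul_of_ne _ _ hb _ _
  · simp

theorem total_one {one : R} (h1 : IsIdentity one) {e f : G} (g : e ⟶ f) :
    α.total g one = α.ident g := by
  have h2 := total_total_inv hα g one
  rw [(h1 _).2] at h2
  have h3 := total_mul hα hc g (α.total (Groupoid.inv g) one) one
  rw [(h1 _).2, h2, ident_mul_total hα] at h3
  exact h3.symm

theorem diag_one_isIdentity [Fintype G] {one : R} (h1 : IsIdentity one) :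
    IsIdentity (α.diag one) := by
  intro x
  induction x using monomial_induction hα with
  | h0 => simp
  | hadd a b ha hb => simp [mul_add, add_mul, ha.1, ha.2, hb.1, hb.2]
  | h g x =>
    rw [diag_mul_monomial hα hc, monomial_mul_diag hα hc, (h1 x).1, total_one hα hc h1,
      ← (hc g).comm, monomial_ident_mul hα hc]
    exact ⟨rfl, rfl⟩

end Monomials

end PartialAction

end PartialSkew

/-! ### The partial permutation of the minimal idempotents, and a central element of trace one. -/

namespace PartialSkew

/-- Multiplication by m is injective, so the identities for t follow from those for m • t, which is
the identity of R. -/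
theorem mem_center_of_nsmul_eq_one {R : Type w} [NonUnitalNonAssocRing R] {one : R}
    (h1 : IsIdentity one) {m : ℕ} {t : R} (ht : m • t = one) : t ∈ Set.center R := by
  have hinj : ∀ x y : R, m • x = m • y → x = y := by
    intro x y h
    rw [← (h1 x).1, ← (h1 y).1, ← ht, smul_mul_assoc, smul_mul_assoc, ← mul_smul_comm,
      ← mul_smul_comm, h]
  refine ⟨fun x => hinj _ _ ?_, fun x y => hinj _ _ ?_, fun x y => hinj _ _ ?_⟩
  · rw [← smul_mul_assoc, ← mul_smul_comm, ht, (h1 x).1, (h1 x).2]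
  · rw [← smul_mul_assoc, ← smul_mul_assoc, ← smul_mul_assoc, ht, (h1 _).1, (h1 x).1]
  · rw [← mul_smul_comm, ← mul_smul_comm, ← mul_smul_comm, ht, (h1 _).2, (h1 y).2]

theorem NatInvertibleIn.exists_of_dvd {R : Type w} [NonUnitalNonAssocRing R] {one : R}
    (h1 : IsIdentity one) {m n : ℕ} (h : NatInvertibleIn n R) (hmn : m ∣ n) :
    ∃ t : R, m • t = one := by
  obtain ⟨one', h1', s, hs, -⟩ := h
  obtain rfl : one' = one := by rw [← (h1 one').1, (h1' one).2]
  obtain ⟨k, rfl⟩ := hmn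
  refine ⟨k • s, ?_⟩
  rw [← mul_smul]
  rwa [smul_mul_assoc, (h1 s).1] at hs

namespace PartialAction

section Trace

variable {G : Type u} [Groupoid.{v} G] {R : Type w} [NonUnitalNonAssocRing R]
variable {α : PartialAction G R}
variable (hα : α.IsUnital) (hc : ∀ {e f : G} (g : e ⟶ f), α.ident g ∈ Set.center R)
variable {one : R} (h1 : IsIdentity one) {n : ℕ} {E : Fin n → R} (hE : SimpleIdempotents one E)

include hα hE

/-- Otherwise 1_e E_i = 0 for all e by `ident_mul_idem`, so E_i kills every R_e, hence R by (P4),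
hence itself. -/
theorem exists_mem_obj (i : Fin n) : ∃ e : G, E i ∈ α.D (𝟙 e) := by
  by_contra! h
  have h0 : ∀ x, E i * x = 0 := by
    refine α.induction_of_obj (mul_zero _) (fun x y hx hy => by rw [mul_add, hx, hy, add_zero]) ?_
    intro e x hx
    have h2 := (ident_mul_idem hα hE (𝟙 e) i).resolve_right fun h' => h e h'.2
    rw [← (ident_mul_of_mem hα (𝟙 e) hx).1, (hE.central i).left_assoc, (hE.central i).comm, h2.1,
      zero_mul]
  exact hE.ne_zero i ((hE.idem i).symm.trans (h0 _))

include hc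

/-- The elements whose image under `total g` lies in the ideal generated by `E j`. -/
def comapIdeal {e f : G} (g : e ⟶ f) (j : Fin n) : TwoSidedIdeal R :=
  TwoSidedIdeal.mk' {x | E j * α.total g x = α.total g x} (by simp)
    (fun {x y} hx hy => by
      simp only [Set.mem_ofPred_eq] at *
      rw [map_add, mul_add, hx, hy])
    (fun {x} hx => by
      simp only [Set.mem_ofPred_eq] at *
      rw [map_neg, mul_neg, hx])
    (fun {x y} hy => by
      simp only [Set.mem_ofPred_eq] at *
      rw [total_mul hα hc, (hE.central j).left_comm, hy])
    (fun {x y} hx => by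
      simp only [Set.mem_ofPred_eq] at *
      rw [total_mul hα hc, (hE.central j).left_assoc, hx])

theorem mem_comapIdeal {e f : G} (g : e ⟶ f) (j : Fin n) {x : R} :
    x ∈ comapIdeal hα hc hE g j ↔ E j * α.total g x = α.total g x :=
  TwoSidedIdeal.mem_mk' _ _ _ _ _ _ _

theorem mem_of_total_ne_zero {e f : G} {g : e ⟶ f} {i : Fin n} (h : α.total g (E i) ≠ 0) :
    E i ∈ α.D (Groupoid.inv g) := by
  rcases ident_mul_idem hα hE (Groupoid.inv g) i with h2 | h2
  · rw [← total_ident_mul hα hc, h2.1, map_zero] at h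
    exact absurd rfl h
  · exact h2.2

theorem total_inv_idem {e f : G} {g : e ⟶ f} {i j : Fin n} (h : α.total g (E i) = E j) :
    α.total (Groupoid.inv g) (E j) = E i := by
  have h2 := mem_of_total_ne_zero hα hc hE (g := g) (i := i) (by rw [h]; exact hE.ne_zero j)
  rw [← h, total_inv_total hα, (ident_mul_of_mem hα _ h2).1]

include h1

/-- A non-zero x = α_g(E_i) meets some E_j. Minimality of E_i, applied to a pulled-back ideal, gives
E_j x = x; minimality of E_j, applied along g⁻¹, gives the reverse containment. So x and E_j absorb
each other. -/
theorem total_idem {e f : G} (g : e ⟶ f) (i : Fin n) :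
    α.total g (E i) = 0 ∨ ∃ j, α.total g (E i) = E j := by
  by_cases h0 : α.total g (E i) = 0
  · exact Or.inl h0
  right
  set x := α.total g (E i) with hx
  have hxi : α.total (Groupoid.inv g) x = E i := by
    rw [hx, total_inv_total hα, (ident_mul_of_mem hα _ (mem_of_total_ne_zero hα hc hE h0)).1]
  obtain ⟨j, hj⟩ : ∃ j, E j * x ≠ 0 := by
    by_contra! h
    apply h0
    rw [← (h1 x).1, ← hE.sum_eq, Finset.sum_mul]
    exact Finset.sum_eq_zero fun j _ => h j
  refine ⟨j, ?_⟩
  have hmem : E j * x ∈ α.D g := (α.mul_mem_D g (total_mem g _) _).2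
  have hg : α.total g (α.total (Groupoid.inv g) (E j * x)) = E j * x := by
    rw [total_total_inv hα, (ident_mul_of_mem hα g hmem).1]
  have hjx : E j * x = x := by
    rw [← mem_comapIdeal hα hc hE]
    refine hE.minimal i _ (α.total (Groupoid.inv g) (E j * x)) ?_ ?_ ?_
    · rw [mem_comapIdeal, hg, (hE.central j).left_assoc, hE.idem]
    · intro h; rw [h, map_zero] at hg; exact hj hg.symm
    · rw [total_mul hα hc, hxi, (hE.central i).left_comm, hE.idem]
  have hmemj : E j ∈ α.D g := by
    rw [← mem_ideal]
    exact hE.minimal j _ x ((mem_ideal _ _).2 (total_mem g _)) h0 hjx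
  have h2 : E i * α.total (Groupoid.inv g) (E j) = α.total (Groupoid.inv g) (E j) := by
    rw [← mem_comapIdeal hα hc hE]
    refine hE.minimal j _ x ?_ h0 hjx
    rw [mem_comapIdeal, hxi, hE.idem]
  have h3 : α.total (Groupoid.inv g) (E j) = E i := by
    rw [← h2]
    nth_rw 1 [← hxi]
    rw [← total_mul hα hc, ← (hE.central j).comm, hjx, hxi]
  rw [hx, ← h3, total_total_inv hα, (ident_mul_of_mem hα g hmemj).1]

theorem idem_mul_total [DecidableEq R] {e f : G} (g : e ⟶ f) (i j : Fin n) :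
    E j * α.total g (E i) = if α.total g (E i) = E j then E j else 0 := by
  split_ifs with h
  · rw [h, hE.idem]
  · rcases total_idem hα hc h1 hE g i with h2 | ⟨k, h2⟩
    · rw [h2, mul_zero]
    · rw [h2] at h ⊢
      exact hE.ortho j k fun hjk => h (hjk ▸ rfl)

/-- By `total_total` only 1_g α_{gh}(E_i) is known to be E_l; the factor 1_g disappears because
α_{gh}(E_i) is zero or minimal. -/
theorem total_comp_idem {e f k : G} {g : f ⟶ k} {h : e ⟶ f} {i j l : Fin n}
    (hh : α.total h (E i) = E j) (hg : α.total g (E j) = E l) :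
    α.total (h ≫ g) (E i) = E l := by
  have h2 := total_total hα hc g h (E i)
  rw [hh, hg] at h2
  rcases total_idem hα hc h1 hE (h ≫ g) i with h3 | ⟨m, h3⟩
  · rw [h3, mul_zero] at h2
    exact absurd h2 (hE.ne_zero l)
  · rw [h3] at h2 ⊢
    rcases ident_mul_idem hα hE g m with h4 | h4
    · rw [h4.1] at h2
      exact absurd h2 (hE.ne_zero l)
    · rw [h2, h4.1]

/-- The stabilizer of a minimal central idempotent. -/
def stabilizer {e : G} {i : Fin n} (hi : E i ∈ α.D (𝟙 e)) : Subgroup (e ⟶ e) where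
  carrier := {g | α.total g (E i) = E i}
  mul_mem' := fun {a b} (ha : α.total a (E i) = E i) hb =>
    total_comp_idem hα hc h1 hE (h := a) (g := b) ha hb
  one_mem' := by
    change α.total (𝟙 e) (E i) = E i
    rw [total_id, (ident_mul_of_mem hα _ hi).1]
  inv_mem' := fun {g} hg => total_inv_idem hα hc hE (g := g) hg

/-- The transporter is the coset of the stabilizer through g₀. Arrows from other objects cannot
occur, since E_i lies in only one R_e. -/
theorem card_transporter {c e : G} {i j : Fin n} (hi : E i ∈ α.D (𝟙 e)) (g₀ : e ⟶ c)
    (hg₀ : α.total g₀ (E i) = E j) :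
    Nat.card {g : Σ e, (e ⟶ c) // α.total g.2 (E i) = E j} =
      Nat.card (stabilizer hα hc h1 hE hi) := by
  refine (Nat.card_congr (Equiv.ofBijective (fun h : stabilizer hα hc h1 hE hi =>
    ⟨⟨e, h.1 ≫ g₀⟩, total_comp_idem hα hc h1 hE h.2 hg₀⟩) ⟨?_, ?_⟩)).symm
  · intro a b hab
    have h2 := congrArg Subtype.val hab
    simp only [Sigma.mk.injEq, heq_eq_eq, true_and] at h2
    apply Subtype.ext
    have h3 := congrArg (· ≫ Groupoid.inv g₀) h2
    simpa only [comp_comp_inv] using h3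
  · rintro ⟨⟨d, g⟩, hg⟩
    dsimp only at hg
    have hd : d = e := by
      by_contra hde
      have h3 := mem_of_total_ne_zero hα hc hE (g := g) (i := i) (by rw [hg]; exact hE.ne_zero j)
      exact hE.ne_zero i (α.eq_zero_of_mem_of_mem hde (α.le_cod _ h3) hi)
    subst hd
    refine ⟨⟨g ≫ Groupoid.inv g₀, total_comp_idem hα hc h1 hE hg
      (total_inv_idem hα hc hE hg₀)⟩, ?_⟩
    apply Subtype.ext
    simp

omit hα hc hE in
theorem total_mul_of_nsmul_eq_one {e f : G} (g : e ⟶ f) {m : ℕ} {t : R} (ht : m • t = one)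
    (x : R) : α.total g (t * x) = t * α.total g x := by
  conv_rhs => rw [← (h1 x).1, ← ht, smul_mul_assoc, map_nsmul, mul_smul_comm, ← smul_mul_assoc,
    ht, (h1 _).1]

/-- There is a central element of trace one. -/
theorem exists_trace_eq_one [Fintype G] [∀ e f : G, Fintype (e ⟶ f)]
    (hinv : ∀ e : G, NatInvertibleIn (Nat.card (e ⟶ e)) R) :
    ∃ a ∈ Set.center R, ∀ c : G, ∑ g : Σ e, (e ⟶ c), α.total g.2 a = α.ident (𝟙 c) := by
  classical
  choose o ho using exists_mem_obj hα hE (G := G)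
  have ht : ∀ i, ∃ t, Nat.card (stabilizer hα hc h1 hE (ho i)) • t = one := fun i =>
    (hinv (o i)).exists_of_dvd h1 (Subgroup.card_subgroup_dvd_card _)
  choose t ht using ht
  have htc := fun i => mem_center_of_nsmul_eq_one h1 (ht i)
  let S : Setoid (Fin n) :=
    { r := fun i j => ∃ g : o i ⟶ o j, α.total g (E i) = E j
      iseqv :=
        { refl := fun i => ⟨𝟙 _, by rw [total_id, (ident_mul_of_mem hα _ (ho i)).1]⟩
          symm := fun ⟨g, hg⟩ => ⟨Groupoid.inv g, total_inv_idem hα hc hE hg⟩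
          trans := fun ⟨g, hg⟩ ⟨h, hh⟩ => ⟨g ≫ h, total_comp_idem hα hc h1 hE hg hh⟩ } }
  -- One representative per orbit, divided by the order of its stabilizer.
  refine ⟨∑ q : Quotient S, t q.out * E q.out, ?_, fun c => ?_⟩
  · rw [← NonUnitalSubring.coe_center]
    exact sum_mem fun q _ => mul_mem (htc _) (hE.central _)
  suffices h : ∀ j, E j * (∑ g : Σ e, (e ⟶ c), α.total g.2 (∑ q : Quotient S, t q.out * E q.out)) =
      E j * α.ident (𝟙 c) by
    have h2 : ∀ x y : R, (∀ j, E j * x = E j * y) → x = y := by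
      intro x y hxy
      rw [← (h1 x).1, ← (h1 y).1, ← hE.sum_eq, Finset.sum_mul, Finset.sum_mul]
      exact Finset.sum_congr rfl fun j _ => hxy j
    exact h2 _ _ h
  intro j
  -- If E_j does not live over c, both sides vanish.
  by_cases hj : o j = c
  swap
  · have h0 : ∀ x ∈ α.D (𝟙 c), E j * x = 0 := fun x hx =>
      α.eq_zero_of_mem_of_mem hj (α.mul_mem_D _ (ho j) _).1 (α.mul_mem_D _ hx _).2
    rw [h0 _ (α.ident_mem _), h0 _ (sum_mem fun g _ => α.le_cod _ (total_mem _ _))]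
  subst hj
  rw [← (hE.central j).comm (α.ident _) |>.symm.eq, (ident_mul_of_mem hα _ (ho j)).1]
  simp only [map_sum]
  rw [Finset.sum_comm, Finset.mul_sum, Finset.sum_eq_single (⟦j⟧ : Quotient S)]
  -- Only the orbit of j contributes. Its representative is carried to E_j by exactly as many arrows
  -- as its stabilizer has elements, which cancels `t i`.
  · have hij : S.r (⟦j⟧ : Quotient S).out j := Quotient.mk_out (s := S) j
    set i := (⟦j⟧ : Quotient S).out
    obtain ⟨g₀, hg₀⟩ := hij
    simp only [total_mul_of_nsmul_eq_one h1 _ (ht i)]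
    rw [← Finset.mul_sum, (hE.central j).left_comm, Finset.mul_sum]
    simp only [idem_mul_total hα hc h1 hE]
    rw [← Finset.sum_filter, Finset.sum_const, ← Fintype.card_subtype, ← Nat.card_eq_fintype_card,
      card_transporter hα hc h1 hE (ho i) g₀ hg₀, mul_smul_comm, ← smul_mul_assoc, ht, (h1 _).1]
  · intro q _ hq
    rw [Finset.mul_sum]
    refine Finset.sum_eq_zero fun g _ => ?_
    rw [total_mul_of_nsmul_eq_one h1 _ (ht _), (hE.central j).left_comm,
      idem_mul_total hα hc h1 hE, if_neg, mul_zero]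
    intro hg
    apply hq
    rw [← q.out_eq]
    apply Quotient.sound
    obtain ⟨e, g⟩ := g
    have he : e = o q.out := by
      by_contra hne
      have h3 := mem_of_total_ne_zero hα hc hE (g := g) (i := q.out)
        (by rw [hg]; exact hE.ne_zero j)
      exact hE.ne_zero _ (α.eq_zero_of_mem_of_mem hne (α.le_cod _ h3) (ho _))
    subst he
    exact ⟨g, hg⟩
  · simp

end Trace

end PartialAction

end PartialSkew

/-! ### Maschke averaging of projections onto ideals. -/

namespace PartialSkew

/-- Composition with `k : d ⟶ c` identifies the arrows into `d` with the arrows into `c`. -/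
def postcompEquiv {G : Type u} [Groupoid.{v} G] {d c : G} (k : d ⟶ c) :
    (Σ e, (e ⟶ d)) ≃ (Σ e, (e ⟶ c)) where
  toFun h := ⟨h.1, h.2 ≫ k⟩
  invFun g := ⟨g.1, g.2 ≫ Groupoid.inv k⟩
  left_inv h := by simp
  right_inv g := by simp

section Projections

variable {A : Type w} [NonUnitalNonAssocRing A] {X : Set A}

theorem exists_submodule_mem_iff (I : Submodule (multRing (Set.univ : Set A)) A) :
    ∃ I' : Submodule (multRing X) A, ∀ y, y ∈ I' ↔ y ∈ I :=
  ⟨toSubmodule I.toAddSubgroup (fun x _ _ hy => submodule_mul_mem_left I x hy)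
    (fun x _ _ hy => submodule_mul_mem_right I x hy), fun _ => mem_toSubmodule⟩

theorem exists_linearMap_projection (h : IsSemisimpleModule (multRing X) A)
    (I : Submodule (multRing X) A) :
    ∃ P : A →ₗ[multRing X] A, (∀ y, P y ∈ I) ∧ ∀ y ∈ I, P y = y := by
  obtain ⟨C, hC⟩ := exists_isCompl I
  exact ⟨I.projection C hC, I.projection_apply_mem hC,
    fun _ hy => I.projection_apply_of_mem_left hC hy⟩

theorem exists_addMonoidHom_of_linearMap (P : A →ₗ[multRing X] A) :
    ∃ p : A →+ A, (∀ y, p y = P y) ∧ (∀ x ∈ X, ∀ y, p (x * y) = x * p y) ∧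
      ∀ x ∈ X, ∀ y, p (y * x) = p y * x := by
  refine ⟨P.toAddMonoidHom, fun y => rfl, fun x hx y => ?_, fun x hx y => ?_⟩
  · have := P.map_smul (multRing.left x hx) y
    rw [multRing.left_smul, multRing.left_smul] at this
    exact this
  · have := P.map_smul (multRing.right x hx) y
    rw [multRing.right_smul, multRing.right_smul] at this
    exact this

theorem exists_projection (h : IsSemisimpleModule (multRing X) A)
    (I : Submodule (multRing (Set.univ : Set A)) A) :
    ∃ p : A →+ A, (∀ x ∈ X, ∀ y, p (x * y) = x * p y) ∧ (∀ x ∈ X, ∀ y, p (y * x) = p y * x) ∧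
      (∀ y, p y ∈ I) ∧ ∀ y ∈ I, p y = y := by
  obtain ⟨I', hI'⟩ := exists_submodule_mem_iff (X := X) I
  obtain ⟨P, hP, hP'⟩ := exists_linearMap_projection h I'
  obtain ⟨p, hp, hl, hr⟩ := exists_addMonoidHom_of_linearMap P
  refine ⟨p, hl, hr, fun y => ?_, fun y hy => ?_⟩
  · rw [hp, ← hI']; exact hP y
  · rw [hp]; exact hP' y ((hI' y).2 hy)

theorem exists_isCompl_of_projection (I : Submodule (multRing X) A) (p : A →+ A)
    (hl : ∀ x ∈ X, ∀ y, p (x * y) = x * p y) (hr : ∀ x ∈ X, ∀ y, p (y * x) = p y * x)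
    (hI : ∀ y, p y ∈ I) (hf : ∀ y ∈ I, p y = y) : ∃ J, IsCompl I J :=
  ⟨_, LinearMap.isCompl_of_proj (f := (toLinearMap p hl hr).codRestrict I hI)
    fun x => Subtype.ext (hf x x.2)⟩

end Projections

namespace PartialAction

section Maschke

variable {G : Type u} [Groupoid.{v} G] {R : Type w} [NonUnitalNonAssocRing R]
variable {α : PartialAction G R}

variable (α) in
/-- The average of `p` with respect to left multiplications. -/
noncomputable def leftAverage [Fintype G] [∀ e f : G, Fintype (e ⟶ f)] (one a : R)
    (p : α.SkewRing →+ α.SkewRing) : α.SkewRing →+ α.SkewRing :=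
  AddMonoidHom.mk' (fun y => ∑ c : G, ∑ g : Σ e, (e ⟶ c),
    α.monomial g.2 (α.total g.2 a) * p (α.monomial (Groupoid.inv g.2) one * y)) (fun x y => by
      simp only [mul_add, map_add, Finset.sum_add_distrib])

theorem leftAverage_apply [Fintype G] [∀ e f : G, Fintype (e ⟶ f)] (one a : R)
    (p : α.SkewRing →+ α.SkewRing) (y : α.SkewRing) :
    α.leftAverage one a p y = ∑ c : G, ∑ g : Σ e, (e ⟶ c),
      α.monomial g.2 (α.total g.2 a) * p (α.monomial (Groupoid.inv g.2) one * y) := rfl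

variable (α) in
/-- The average of `p` with respect to right multiplications. -/
noncomputable def rightAverage [Fintype G] [∀ e f : G, Fintype (e ⟶ f)] (one a : R)
    (p : α.SkewRing →+ α.SkewRing) : α.SkewRing →+ α.SkewRing :=
  AddMonoidHom.mk' (fun y => ∑ c : G, ∑ h : Σ e, (e ⟶ c),
    p (y * α.monomial h.2 one) * α.monomial (Groupoid.inv h.2) a) (fun x y => by
      simp only [add_mul, map_add, Finset.sum_add_distrib])

theorem rightAverage_apply [Fintype G] [∀ e f : G, Fintype (e ⟶ f)] (one a : R)
    (p : α.SkewRing →+ α.SkewRing) (y : α.SkewRing) :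
    α.rightAverage one a p y = ∑ c : G, ∑ h : Σ e, (e ⟶ c),
      p (y * α.monomial h.2 one) * α.monomial (Groupoid.inv h.2) a := rfl

variable (hα : α.IsUnital) (hc : ∀ {e f : G} (g : e ⟶ f), α.ident g ∈ Set.center R)
variable {one : R} (h1 : IsIdentity one)
variable [Fintype G]

include hα hc h1

theorem monomial_eq_diag_mul {e f : G} (g : e ⟶ f) (x : R) :
    α.monomial g x = α.diag x * α.monomial g one := by
  rw [diag_mul_monomial hα hc, (h1 x).2]

theorem monomial_comp_one {e f k : G} (g : f ⟶ k) (h : e ⟶ f) :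
    α.monomial g one * α.monomial h one = α.diag (α.ident g) * α.monomial (h ≫ g) one := by
  rw [monomial_mul hα hc, diag_mul_monomial hα hc, (h1 _).1, (h1 _).2, total_one hα hc h1]

variable [∀ e f : G, Fintype (e ⟶ f)] {a : R} (ha : a ∈ Set.center R)
variable {p : α.SkewRing →+ α.SkewRing}

section Left

include ha

/-- The coefficient r becomes α_{g⁻¹}(r) on passing δ_{g⁻¹}, goes through p, and becomes r again on
passing δ_g; centrality of a lets it move to the front. -/
theorem leftAverage_diag_mul (hl : ∀ r y, p (α.diag r * y) = α.diag r * p y) (r : R)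
    (y : α.SkewRing) :
    α.leftAverage one a p (α.diag r * y) = α.diag r * α.leftAverage one a p y := by
  simp only [leftAverage_apply, Finset.mul_sum]
  refine Finset.sum_congr rfl fun c _ => Finset.sum_congr rfl fun g _ => ?_
  obtain ⟨e, g⟩ := g
  have n1 := monomial_isNuclear hα hc (Groupoid.inv g) h1.mem_center
  have hag := total_center hα hc g ha
  have n2 := monomial_isNuclear hα hc g hag
  have e1 : α.monomial (Groupoid.inv g) one * α.diag r =
      α.diag (α.total (Groupoid.inv g) r) * α.monomial (Groupoid.inv g) one := by
    rw [monomial_mul_diag hα hc, diag_mul_monomial hα hc, (h1 _).1, (h1 _).2]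
  have e2 : α.monomial g (α.total g a) * α.diag (α.total (Groupoid.inv g) r) =
      α.diag r * α.monomial g (α.total g a) := by
    rw [monomial_mul_diag hα hc, diag_mul_monomial hα hc, total_total_inv hα, ← (hc g).left_comm,
      monomial_ident_mul hα hc, hag.comm]
  rw [← n1.left, e1, n1.mid, hl, ← n2.left, e2, n2.mid]

theorem leftAverage_mul_diag (hr : ∀ r y, p (y * α.diag r) = p y * α.diag r) (r : R)
    (y : α.SkewRing) :
    α.leftAverage one a p (y * α.diag r) = α.leftAverage one a p y * α.diag r := by
  simp only [leftAverage_apply, Finset.sum_mul]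
  refine Finset.sum_congr rfl fun c _ => Finset.sum_congr rfl fun g _ => ?_
  rw [← (monomial_isNuclear hα hc _ h1.mem_center).left, hr,
    (monomial_isNuclear hα hc _ (total_center hα hc _ ha)).left]

/-- The substitution g = kh matches the terms. As the action is only partial, δ_{(kh)⁻¹} δ_k is
δ_{h⁻¹} times 1_{(kh)⁻¹}; such diagonal factors pass through p and are absorbed by the weight. -/
theorem leftAverage_monomial_mul (hl : ∀ r y, p (α.diag r * y) = α.diag r * p y) {d c : G}
    (k : d ⟶ c) (y : α.SkewRing) :
    α.leftAverage one a p (α.monomial k one * y) =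
      α.monomial k one * α.leftAverage one a p y := by
  have nk := monomial_isNuclear hα hc k h1.mem_center
  simp only [leftAverage_apply, Finset.mul_sum]
  rw [Finset.sum_eq_single c, Finset.sum_eq_single d]
  · rw [← (postcompEquiv k).sum_comp]
    refine Finset.sum_congr rfl fun h _ => ?_
    obtain ⟨e, h⟩ := h
    change α.monomial (h ≫ k) (α.total (h ≫ k) a) *
      p (α.monomial (Groupoid.inv (h ≫ k)) one * (α.monomial k one * y)) =
      α.monomial k one * (α.monomial h (α.total h a) * p (α.monomial (Groupoid.inv h) one * y))
    have hag := total_center hα hc (h ≫ k) ha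
    have nx := monomial_isNuclear hα hc (h ≫ k) hag
    have nm := monomial_isNuclear hα hc (Groupoid.inv h) h1.mem_center
    have e0 : k ≫ Groupoid.inv (h ≫ k) = Groupoid.inv h := by simp
    have e1 : α.monomial (h ≫ k) (α.total (h ≫ k) a) *
        α.diag (α.ident (Groupoid.inv (h ≫ k))) = α.monomial (h ≫ k) (α.total (h ≫ k) a) := by
      rw [monomial_mul_diag hα hc, total_ident hα hc, Groupoid.inv_comp, ident_mul_ident_cod hα,
        total_mul_ident hα]
    have e2 : α.monomial (Groupoid.inv h) one =
        α.diag (α.ident (Groupoid.inv h)) * α.monomial (Groupoid.inv h) one := by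
      rw [diag_mul_monomial hα hc, monomial_ident_mul hα hc]
    have e3 : α.monomial (h ≫ k) (α.total (h ≫ k) a) * α.diag (α.ident (Groupoid.inv h)) =
        α.monomial k one * α.monomial h (α.total h a) := by
      rw [monomial_mul_diag hα hc, monomial_mul hα hc, total_ident hα hc, inv_comp_comp,
        total_total hα hc, (h1 _).1, ← (hc (h ≫ k)).left_comm, monomial_ident_mul hα hc, hag.comm]
    rw [← (monomial_isNuclear hα hc _ h1.mem_center).left, monomial_comp_one hα hc h1, e0,
      nm.mid, hl, ← nx.left, e1]
    conv_lhs => rw [e2]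
    rw [nm.mid, hl, ← nx.left, e3, nk.left]
  · intro b _ hb
    refine Finset.sum_eq_zero fun h _ => ?_
    rw [← nk.left, monomial_mul_of_ne _ _ hb, zero_mul]
  · simp
  · intro b _ hb
    refine Finset.sum_eq_zero fun h _ => ?_
    rw [← nk.mid, monomial_mul_of_ne _ _ hb.symm, zero_mul, map_zero, mul_zero]
  · simp

omit ha in
-- With p removed, the arrows into c contribute the trace of a at c times y, that is, 1_c δ_c y;
-- these add up to y over all objects c.
theorem leftAverage_of_fixed (htr : ∀ c : G, ∑ g : Σ e, (e ⟶ c), α.total g.2 a = α.ident (𝟙 c))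
    {y : α.SkewRing} (hy : ∀ x, p (x * y) = x * y) : α.leftAverage one a p y = y := by
  have key : ∀ (c : G) (g : Σ e, (e ⟶ c)),
      α.monomial g.2 (α.total g.2 a) * p (α.monomial (Groupoid.inv g.2) one * y) =
      α.monomial (𝟙 c) (α.total g.2 a) * y := by
    rintro c ⟨e, g⟩
    rw [hy, ← (monomial_isNuclear hα hc _ h1.mem_center).mid, monomial_mul hα hc,
      total_one hα hc h1, total_mul_ident hα, Groupoid.inv_comp]
  have key' : ∀ c : G, ∑ g : Σ e, (e ⟶ c), α.monomial g.2 (α.total g.2 a) *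
      p (α.monomial (Groupoid.inv g.2) one * y) = α.monomial (𝟙 c) one * y := by
    intro c
    rw [Finset.sum_congr rfl fun g _ => key c g, ← Finset.sum_mul, ← map_sum, htr,
      ← (h1 (α.ident _)).2, monomial_ident_mul hα hc]
  rw [leftAverage_apply, Finset.sum_congr rfl fun c _ => key' c, ← Finset.sum_mul, ← diag_apply,
    (diag_one_isIdentity hα hc h1 y).1]

end Left

section Right

theorem rightAverage_mul_diag (ha : a ∈ Set.center R)
    (hr : ∀ r y, p (y * α.diag r) = p y * α.diag r) (r : R) (y : α.SkewRing) :
    α.rightAverage one a p (y * α.diag r) = α.rightAverage one a p y * α.diag r := by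
  simp only [rightAverage_apply, Finset.sum_mul]
  refine Finset.sum_congr rfl fun c _ => Finset.sum_congr rfl fun h _ => ?_
  obtain ⟨e, h⟩ := h
  have n1 := monomial_isNuclear hα hc h h1.mem_center
  have n2 := monomial_isNuclear hα hc (Groupoid.inv h) ha
  have e1 : α.diag r * α.monomial h one =
      α.monomial h one * α.diag (α.total (Groupoid.inv h) r) := by
    rw [monomial_mul_diag hα hc, diag_mul_monomial hα hc, total_total_inv hα, (h1 _).1, (h1 _).2,
      monomial_ident_mul hα hc]
  have e2 : α.diag (α.total (Groupoid.inv h) r) * α.monomial (Groupoid.inv h) a =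
      α.monomial (Groupoid.inv h) a * α.diag r := by
    rw [monomial_mul_diag hα hc, diag_mul_monomial hα hc, ha.comm]
  change p (y * α.diag r * α.monomial h one) * α.monomial (Groupoid.inv h) a =
    p (y * α.monomial h one) * α.monomial (Groupoid.inv h) a * α.diag r
  rw [n1.right, e1, ← n1.mid, hr, n2.right, e2, ← n2.mid]

theorem rightAverage_mul_left (ha : a ∈ Set.center R) {t : α.SkewRing}
    (ht : ∀ y, p (t * y) = t * p y) (y : α.SkewRing) :
    α.rightAverage one a p (t * y) = t * α.rightAverage one a p y := by
  simp only [rightAverage_apply, Finset.mul_sum]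
  refine Finset.sum_congr rfl fun c _ => Finset.sum_congr rfl fun h _ => ?_
  rw [(monomial_isNuclear hα hc _ h1.mem_center).right, ht, (monomial_isNuclear hα hc _ ha).right]

theorem rightAverage_mul_monomial (ha : a ∈ Set.center R)
    (hr : ∀ r y, p (y * α.diag r) = p y * α.diag r) {d c : G} (k : d ⟶ c) (y : α.SkewRing) :
    α.rightAverage one a p (y * α.monomial k one) =
      α.rightAverage one a p y * α.monomial k one := by
  have nk := monomial_isNuclear hα hc k h1.mem_center
  simp only [rightAverage_apply, Finset.sum_mul]
  rw [Finset.sum_eq_single d, Finset.sum_eq_single c]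
  · rw [← (postcompEquiv k).sum_comp]
    refine Finset.sum_congr rfl fun h _ => ?_
    obtain ⟨e, h⟩ := h
    change p (y * α.monomial k one * α.monomial h one) * α.monomial (Groupoid.inv h) a =
      p (y * α.monomial (h ≫ k) one) * α.monomial (Groupoid.inv (h ≫ k)) a * α.monomial k one
    have nu := monomial_isNuclear hα hc (h ≫ k) h1.mem_center
    have nz := monomial_isNuclear hα hc (Groupoid.inv h) ha
    have e0 : k ≫ Groupoid.inv (h ≫ k) = Groupoid.inv h := by simp
    have e1 : α.monomial k one * α.monomial h one =
        α.monomial (h ≫ k) one * α.diag (α.ident (Groupoid.inv h)) := by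
      rw [monomial_comp_one hα hc h1, diag_mul_monomial hα hc, monomial_mul_diag hα hc,
        total_ident hα hc, inv_comp_comp, (h1 _).1, (h1 _).2, monomial_ident_mul hα hc]
    have e2 : α.diag (α.ident (Groupoid.inv h)) * α.monomial (Groupoid.inv h) a =
        α.monomial (Groupoid.inv h) a := by
      rw [diag_mul_monomial hα hc, monomial_ident_mul hα hc]
    have e3 : α.monomial (Groupoid.inv (h ≫ k)) a * α.monomial k one =
        α.diag (α.ident (Groupoid.inv (h ≫ k))) * α.monomial (Groupoid.inv h) a := by
      rw [monomial_mul hα hc, diag_mul_monomial hα hc, e0, total_one hα hc h1, ha.comm]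
    have e4 : α.monomial (h ≫ k) one * α.diag (α.ident (Groupoid.inv (h ≫ k))) =
        α.monomial (h ≫ k) one := by
      rw [monomial_mul_diag hα hc, total_ident hα hc, Groupoid.inv_comp, ident_mul_ident_cod hα,
        (h1 _).1, ← (h1 (α.ident (h ≫ k))).2, monomial_ident_mul hα hc]
    -- Two diagonal idempotents are moved through p: 1_{h⁻¹} outwards, to be absorbed by the weight,
    -- and 1_{(kh)⁻¹} inwards, to be absorbed by δ_{kh}.
    rw [nk.mid, e1, ← nu.mid, hr, nz.right, e2, nk.right, e3, ← nz.right, ← hr, nu.mid, e4]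
  · intro b _ hb
    refine Finset.sum_eq_zero fun h _ => ?_
    rw [nk.right, monomial_mul_of_ne _ _ hb.symm, mul_zero]
  · simp
  · intro b _ hb
    refine Finset.sum_eq_zero fun h _ => ?_
    rw [nk.mid, monomial_mul_of_ne _ _ hb, mul_zero, map_zero, zero_mul]
  · simp

theorem rightAverage_of_fixed (ha : a ∈ Set.center R)
    (htr : ∀ c : G, ∑ g : Σ e, (e ⟶ c), α.total g.2 a = α.ident (𝟙 c))
    {y : α.SkewRing} (hy : ∀ x, p (y * x) = y * x) : α.rightAverage one a p y = y := by
  have key : ∀ (c : G) (g : Σ e, (e ⟶ c)),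
      p (y * α.monomial g.2 one) * α.monomial (Groupoid.inv g.2) a =
      y * α.monomial (𝟙 c) (α.total g.2 a) := by
    rintro c ⟨e, g⟩
    rw [hy, (monomial_isNuclear hα hc _ ha).right, monomial_mul hα hc, (h1 _).1,
      Groupoid.inv_comp]
  have key' : ∀ c : G, ∑ g : Σ e, (e ⟶ c), p (y * α.monomial g.2 one) *
      α.monomial (Groupoid.inv g.2) a = y * α.monomial (𝟙 c) one := by
    intro c
    rw [Finset.sum_congr rfl fun g _ => key c g, ← Finset.mul_sum, ← map_sum, htr,
      ← (h1 (α.ident _)).2, monomial_ident_mul hα hc]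
  rw [rightAverage_apply, Finset.sum_congr rfl fun c _ => key' c, ← Finset.mul_sum, ← diag_apply,
    (diag_one_isIdentity hα hc h1 y).2]

end Right

/-- A version of Maschke's theorem for ideals of the partial skew groupoid ring. -/
theorem isSemisimpleModule_of_diag (ha : a ∈ Set.center R)
    (htr : ∀ c : G, ∑ g : Σ e, (e ⟶ c), α.total g.2 a = α.ident (𝟙 c))
    (h : IsSemisimpleModule (multRing (Set.range α.diag)) α.SkewRing) :
    IsSemisimpleModule (multRing (Set.univ : Set α.SkewRing)) α.SkewRing := by
  refine { exists_isCompl := fun I => ?_ }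
  obtain ⟨p, hl, hr, hpI, hpf⟩ := exists_projection h I
  replace hl : ∀ r y, p (α.diag r * y) = α.diag r * p y := fun r => hl _ ⟨r, rfl⟩
  replace hr : ∀ r y, p (y * α.diag r) = p y * α.diag r := fun r => hr _ ⟨r, rfl⟩
  set p₁ := α.leftAverage one a p with hp₁
  have h₁r : ∀ r y, p₁ (y * α.diag r) = p₁ y * α.diag r := fun r y =>
    leftAverage_mul_diag hα hc h1 ha hr r y
  have h₁I : ∀ y, p₁ y ∈ I := fun y => by
    rw [hp₁, leftAverage_apply]
    exact sum_mem fun c _ => sum_mem fun g _ => submodule_mul_mem_left I _ (hpI _)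
  have h₁f : ∀ y ∈ I, p₁ y = y := fun y hy =>
    leftAverage_of_fixed hα hc h1 htr fun x => hpf _ (submodule_mul_mem_left I x hy)
  -- The right average keeps the left linearity already obtained for `p₁`, so `p₂` is linear on both
  -- sides.
  set p₂ := α.rightAverage one a p₁ with hp₂
  have h₂I : ∀ y, p₂ y ∈ I := fun y => by
    rw [hp₂, rightAverage_apply]
    exact sum_mem fun c _ => sum_mem fun g _ => submodule_mul_mem_right I _ (h₁I _)
  have h₂f : ∀ y ∈ I, p₂ y = y := fun y hy =>
    rightAverage_of_fixed hα hc h1 ha htr fun x => h₁f _ (submodule_mul_mem_right I x hy)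
  have h₂l : ∀ x ∈ (Set.univ : Set α.SkewRing), ∀ y, p₂ (x * y) = x * p₂ y := by
    intro x _ y
    induction x using monomial_induction hα with
    | h0 => rw [zero_mul, zero_mul, map_zero]
    | hadd u v hu hv => rw [add_mul, add_mul, map_add, hu trivial, hv trivial]
    | h g x =>
      have n := monomial_isNuclear hα hc g h1.mem_center
      rw [monomial_eq_diag_mul hα hc h1, n.mid, n.mid,
        rightAverage_mul_left hα hc h1 ha (leftAverage_diag_mul hα hc h1 ha hl x),
        rightAverage_mul_left hα hc h1 ha (leftAverage_monomial_mul hα hc h1 ha hl g)]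
  have h₂r : ∀ x ∈ (Set.univ : Set α.SkewRing), ∀ y, p₂ (y * x) = p₂ y * x := by
    intro x _ y
    induction x using monomial_induction hα with
    | h0 => rw [mul_zero, mul_zero, map_zero]
    | hadd u v hu hv => rw [mul_add, mul_add, map_add, hu trivial, hv trivial]
    | h g x =>
      have n := monomial_isNuclear hα hc g h1.mem_center
      rw [monomial_eq_diag_mul hα hc h1, ← n.right, ← n.right,
        rightAverage_mul_monomial hα hc h1 ha h₁r, rightAverage_mul_diag hα hc h1 ha h₁r]
  exact exists_isCompl_of_projection I p₂ h₂l h₂r h₂I h₂f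

/-! ### Semisimplicity over the diagonal copy of R. -/

section Restriction

variable {n : ℕ} {E : Fin n → R} (hE : SimpleIdempotents one E)

omit h1 [∀ e f : G, Fintype (e ⟶ f)]

/-- The submodule of all `(1_g E_i r) δ_g`. -/
noncomputable def monomialSubmodule {e f : G} (g : e ⟶ f) (i : Fin n) :
    Submodule (multRing (Set.range α.diag)) α.SkewRing :=
  toSubmodule ((α.monomial g).comp (AddMonoidHom.mulLeft (E i))).range (by
    rintro _ ⟨r, rfl⟩ _ ⟨x, rfl⟩
    refine ⟨r * x, ?_⟩
    change α.monomial g (E i * (r * x)) = α.diag r * α.monomial g (E i * x)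
    rw [diag_mul_monomial hα hc, (hE.central i).left_comm]) (by
    rintro _ ⟨r, rfl⟩ _ ⟨x, rfl⟩
    refine ⟨x * α.total g r, ?_⟩
    change α.monomial g (E i * (x * α.total g r)) = α.monomial g (E i * x) * α.diag r
    rw [monomial_mul_diag hα hc, (hE.central i).left_assoc])

/-- The piece E_i R δ_g is zero or simple. For a submodule J, the x with x δ_g in J form an ideal of
R; if J is non-zero, minimality puts E_i into it. -/
theorem monomialSubmodule_isSemisimple {e f : G} (g : e ⟶ f) (i : Fin n) :
    IsSemisimpleModule (multRing (Set.range α.diag)) (monomialSubmodule hα hc hE g i) := by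
  by_cases h0 : monomialSubmodule hα hc hE g i = ⊥
  · have : Subsingleton (monomialSubmodule hα hc hE g i) :=
      (Submodule.subsingleton_iff_eq_bot).2 h0
    exact { exists_isCompl := fun I => ⟨⊤, by
      rw [Subsingleton.elim I ⊥]; exact isCompl_bot_top⟩ }
  suffices h : IsAtom (monomialSubmodule hα hc hE g i) by
    have := isSimpleModule_iff_isAtom.2 h
    infer_instance
  refine ⟨h0, fun J hJ => ?_⟩
  by_contra hJ0
  apply hJ.not_ge
  obtain ⟨w, hw, hw0⟩ := (Submodule.ne_bot_iff _).1 hJ0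
  obtain ⟨x, rfl⟩ := hJ.le hw
  let K : TwoSidedIdeal R := TwoSidedIdeal.mk' {x | α.monomial g x ∈ J} (by simp [J.zero_mem])
    (fun {x y} hx hy => by
      simp only [Set.mem_ofPred_eq, map_add] at *
      exact J.add_mem hx hy)
    (fun {x} hx => by
      simp only [Set.mem_ofPred_eq, map_neg] at *
      exact J.neg_mem hx)
    (fun {x y} hy => by
      simp only [Set.mem_ofPred_eq] at *
      rw [← diag_mul_monomial hα hc]
      exact J.smul_mem (multRing.left (α.diag x) ⟨x, rfl⟩) hy)
    (fun {x y} hx => by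
      simp only [Set.mem_ofPred_eq] at *
      -- Right multiplication of the coefficient by y is right multiplication of the monomial by the
      -- diagonal element of α_{g⁻¹}(y).
      rw [← monomial_ident_mul hα hc, (hc g).left_comm, ← total_total_inv hα,
        ← monomial_mul_diag hα hc]
      exact J.smul_mem (multRing.right (α.diag _) ⟨_, rfl⟩) hx)
  have hK : ∀ x, x ∈ K ↔ α.monomial g x ∈ J := fun x => TwoSidedIdeal.mem_mk' _ _ _ _ _ _ _
  have hEi : E i ∈ K := by
    refine hE.minimal i K (E i * x) ((hK _).2 hw) ?_ ?_
    · intro h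
      apply hw0
      change α.monomial g (E i * x) = 0
      rw [h, map_zero]
    · rw [(hE.central i).left_assoc, hE.idem]
  rintro _ ⟨r, rfl⟩
  exact (hK _).1 (K.mul_mem_right _ _ hEi)

include h1 hE in
theorem isSemisimpleModule_diag :
    IsSemisimpleModule (multRing (Set.range α.diag)) α.SkewRing := by
  refine isSemisimpleModule_of_isSemisimpleModule_submodule'
    (p := fun m : Mor G × Fin n => monomialSubmodule hα hc hE m.1.hom m.2)
    (fun m => monomialSubmodule_isSemisimple hα hc hE _ _) ?_
  rw [eq_top_iff]
  intro y _
  induction y using monomial_induction hα with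
  | h0 => exact zero_mem _
  | hadd u v hu hv => exact add_mem (hu trivial) (hv trivial)
  | @h e f g x =>
    have hx : α.monomial g x = ∑ i, α.monomial g (E i * x) := by
      rw [← map_sum, ← Finset.sum_mul, hE.sum_eq, (h1 x).1]
    rw [hx]
    refine sum_mem fun i _ => ?_
    exact Submodule.mem_iSup_of_mem (⟨e, f, g⟩, i) ⟨x, rfl⟩

end Restriction

end Maschke

end PartialAction

end PartialSkew

/-! ### Module-theoretic semisimplicity via artinian rings, and the conclusion. -/

namespace PartialSkew

theorem IsIdentity.eq {A : Type w} [NonUnitalNonAssocRing A] {x y : A} (hx : IsIdentity x)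
    (hy : IsIdentity y) : x = y := by rw [← (hy x).1, (hx y).2]

theorem IsModuleSemisimple.isSemisimple {A : Type w} [NonUnitalNonAssocRing A]
    (h : IsModuleSemisimple A) : IsSemisimple A := by
  obtain ⟨B, _, _, ⟨φ⟩⟩ := h
  obtain ⟨n, D, d, _, _, ⟨ψ⟩⟩ := IsSemisimpleRing.exists_ringEquiv_pi_matrix_divisionRing B
  exact ⟨n, fun i => Matrix (Fin (d i)) (Fin (d i)) (D i), fun i => inferInstance,
    fun i => inferInstance, ⟨φ.trans ψ⟩⟩

/-- A non-zero Jacobson radical would contain some E_i by minimality. Then 1 - E_i would have a left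
inverse, yet it annihilates E_i. -/
theorem IsSemisimple.isSemisimpleRing {B : Type w} [Ring B] [IsArtinianRing B]
    (h : IsSemisimple B) : IsSemisimpleRing B := by
  obtain ⟨n, E, hE⟩ := h.exists_simpleIdempotents (one := 1) fun x => ⟨one_mul x, mul_one x⟩
  rw [IsArtinianRing.isSemisimpleRing_iff_jacobson, eq_bot_iff]
  intro x hx
  by_contra h0
  rw [Submodule.mem_bot] at h0
  obtain ⟨i, hi⟩ : ∃ i, E i * x ≠ 0 := by
    by_contra! h
    apply h0
    rw [← one_mul x, ← hE.sum_eq, Finset.sum_mul]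
    exact Finset.sum_eq_zero fun i _ => h i
  have hEi := hE.minimal i (Ring.jacobson B).toTwoSided (E i * x)
    (Ideal.mem_toTwoSided.2 (Ideal.mul_mem_left _ _ hx)) hi
    (by rw [← mul_assoc, hE.idem])
  rw [Ideal.mem_toTwoSided, ← Ideal.jacobson_bot, Ideal.mem_jacobson_iff] at hEi
  obtain ⟨z, hz⟩ := hEi (-1)
  apply hE.ne_zero i
  have h2 : z * (1 - E i) = 1 := by
    rw [← sub_eq_zero, ← Ideal.mem_bot, ← show z * -1 * E i + z - 1 = z * (1 - E i) - 1 by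
      noncomm_ring]
    exact hz
  calc E i = z * (1 - E i) * E i := by rw [h2, one_mul]
    _ = z * (E i - E i * E i) := by noncomm_ring
    _ = 0 := by rw [hE.idem, sub_self, mul_zero]

theorem isArtinianRing_of_ringHom {A : Type*} {B : Type*} [Ring A] [Ring B] [IsArtinianRing B]
    (ψ : B →+* A) {S : Set A} (hS : S.Finite)
    (h : ∀ x, x ∈ AddSubgroup.closure {y : A | ∃ b, ∃ s ∈ S, y = ψ b * s}) :
    IsArtinianRing A := by
  let _ : Module B A := Module.compHom A ψ
  have : IsScalarTower B A A := ⟨fun b x y => mul_assoc (ψ b) x y⟩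
  have : Module.Finite B A := by
    refine Module.finite_def.2 (Submodule.fg_def.2 ⟨S, hS, ?_⟩)
    rw [eq_top_iff]
    intro x _
    refine (AddSubgroup.closure_le (Submodule.span B S).toAddSubgroup).2 ?_ (h x)
    rintro _ ⟨b, s, hs, rfl⟩
    exact Submodule.smul_mem _ b (Submodule.subset_span hs)
  exact isArtinian_of_tower B (inferInstance : IsArtinian B A)

namespace PartialAction

variable {G : Type u} [Groupoid.{v} G] {R : Type w} [NonUnitalNonAssocRing R]
variable {α : PartialAction G R}
variable (hα : α.IsUnital) (hc : ∀ {e f : G} (g : e ⟶ f), α.ident g ∈ Set.center R)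
variable {one : R} (h1 : IsIdentity one)

theorem isSemisimple_skewRing [Fintype G] [∀ e f : G, Fintype (e ⟶ f)] (hα : α.IsUnital)
    {one : R} (h1 : IsIdentity one) (hinv : ∀ e : G, NatInvertibleIn (Nat.card (e ⟶ e)) R)
    (hR : IsSemisimple R) : IsSemisimple α.SkewRing := by
  obtain ⟨n, E, hE⟩ := hR.exists_simpleIdempotents h1
  have hc : ∀ {e f : G} (g : e ⟶ f), α.ident g ∈ Set.center R := fun g => ident_central hα h1 hE g
  obtain ⟨a, ha, htr⟩ := exists_trace_eq_one hα hc h1 hE hinv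
  exact isSemisimple_of_isSemisimpleModule (diag_one_isIdentity hα hc h1)
    (isSemisimpleModule_of_diag hα hc h1 ha htr (isSemisimpleModule_diag hα hc h1 hE))

include hα hc

theorem diag_mul [Fintype G] (r s : R) : α.diag (r * s) = α.diag r * α.diag s := by
  rw [diag_apply s, Finset.mul_sum, diag_apply]
  exact Finset.sum_congr rfl fun e _ => (diag_mul_monomial hα hc _ _ _).symm

include h1

/-- The partial skew groupoid ring of an associative ring with identity is of the same kind. -/
@[reducible] noncomputable def skewRingRing [Fintype G] (hR : ∀ x y z : R, (x * y) * z = x * (y * z)) :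
    Ring α.SkewRing :=
  { (inferInstance : NonUnitalNonAssocRing α.SkewRing) with
    one := α.diag one
    mul_assoc := skewRing_mul_assoc hα hc hR
    one_mul := fun x => (diag_one_isIdentity hα hc h1 x).1
    mul_one := fun x => (diag_one_isIdentity hα hc h1 x).2 }

/-- The finitely many δ_g generate the skew ring as a left module over the diagonal copy of the
artinian ring `B`. -/
theorem skewRing_isArtinianRing [Fintype G] [Finite (Mor G)] {B : Type w} [Ring B]
    [IsArtinianRing B] (φ : R ≃+* B) (hR : ∀ x y z : R, (x * y) * z = x * (y * z)) :
    @IsArtinianRing α.SkewRing (skewRingRing hα hc h1 hR).toSemiring := by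
  let _ := skewRingRing hα hc h1 hR
  have h1' : φ.symm 1 = one := IsIdentity.eq (fun x => by
    constructor <;> apply φ.injective <;> simp) h1
  let ψ : B →+* α.SkewRing :=
    { toFun := fun b => α.diag (φ.symm b)
      map_zero' := by rw [map_zero]; exact map_zero α.diag
      map_one' := by rw [h1']; rfl
      map_add' := fun x y => by rw [map_add]; exact map_add α.diag _ _
      map_mul' := fun x y => by rw [map_mul]; exact diag_mul hα hc _ _ }
  refine isArtinianRing_of_ringHom ψ (Set.finite_range fun m : Mor G => α.monomial m.hom one)
    fun x => ?_
  induction x using monomial_induction hα with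
  | h0 => exact zero_mem _
  | hadd x y hx hy => exact add_mem hx hy
  | @h e f g x =>
    refine AddSubgroup.subset_closure ⟨φ x, _, ⟨⟨e, f, g⟩, rfl⟩, ?_⟩
    change _ = α.diag (φ.symm (φ x)) * _
    rw [φ.symm_apply_apply]
    exact monomial_eq_diag_mul hα hc h1 g x

omit hα hc h1

theorem isModuleSemisimple_skewRing [Fintype G] [∀ e f : G, Fintype (e ⟶ f)] [Finite (Mor G)]
    (hα : α.IsUnital)
    {one : R} (h1 : IsIdentity one) (hinv : ∀ e : G, NatInvertibleIn (Nat.card (e ⟶ e)) R)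
    (hR : IsModuleSemisimple R) : IsModuleSemisimple α.SkewRing := by
  have hss := isSemisimple_skewRing hα h1 hinv hR.isSemisimple
  obtain ⟨n, E, hE⟩ := hR.isSemisimple.exists_simpleIdempotents h1
  have hc : ∀ {e f : G} (g : e ⟶ f), α.ident g ∈ Set.center R := fun g => ident_central hα h1 hE g
  obtain ⟨B, _, _, ⟨φ⟩⟩ := hR
  have hassoc : ∀ x y z : R, (x * y) * z = x * (y * z) := fun x y z => φ.injective (by
    rw [map_mul, map_mul, map_mul, map_mul, mul_assoc])
  let I := skewRingRing hα hc h1 hassoc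
  have := skewRing_isArtinianRing hα hc h1 φ hassoc
  exact ⟨α.SkewRing, I, IsSemisimple.isSemisimpleRing hss, ⟨RingEquiv.refl _⟩⟩

end PartialAction

end PartialSkew

theorem mainTheorem8 {G : Type u} [Groupoid.{v} G] {R : Type w} [NonUnitalNonAssocRing R]
    (α : PartialSkew.PartialAction G R) (hα : α.IsUnital)
    (hfin : Finite (PartialSkew.Mor G))
    (hinv : ∀ e : G, PartialSkew.NatInvertibleIn (Nat.card (e ⟶ e)) R) :
    (PartialSkew.IsSemisimple R → PartialSkew.IsSemisimple α.SkewRing) ∧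
    (PartialSkew.IsModuleSemisimple R → PartialSkew.IsModuleSemisimple α.SkewRing) := by
  have hG : Finite G := Finite.of_injective (fun e : G => (⟨e, e, 𝟙 e⟩ : PartialSkew.Mor G))
    fun _ _ h => congrArg PartialSkew.Mor.dom h
  have hhom : ∀ e f : G, Finite (e ⟶ f) := fun e f =>
    Finite.of_injective (fun g : e ⟶ f => (⟨e, f, g⟩ : PartialSkew.Mor G)) fun _ _ h => by
      simpa using h
  have : Fintype G := Fintype.ofFinite G
  have : ∀ e f : G, Fintype (e ⟶ f) := fun e f => Fintype.ofFinite _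
  obtain ⟨one, h1⟩ : ∃ one : R, PartialSkew.IsIdentity one := by
    rcases isEmpty_or_nonempty G with h | ⟨⟨e⟩⟩
    -- Without objects the invertibility hypothesis is vacuous, but (P4) makes R the zero ring, with
    -- identity 0.
    · exact ⟨0, α.induction_of_obj (P := fun x => 0 * x = x ∧ x * 0 = x) (by simp)
        (fun x y hx hy => by rw [zero_mul, mul_zero] at *; simp [← hx.1, ← hy.1]) fun e => (h.false e).elim⟩
    · obtain ⟨one, h1, -⟩ := hinv e
      exact ⟨one, h1⟩
  exact ⟨PartialSkew.PartialAction.isSemisimple_skewRing hα h1 hinv,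
    PartialSkew.PartialAction.isModuleSemisimple_skewRing hα h1 hinv⟩
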